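/- Let $\mathbf k$ be a field of characteristic zero. A graded PROP over $\mathbf k$ is a strict symmetric monoidal category enriched in $\mathbb Z$-graded $\mathbf k$-vector spaces (with the Koszul sign rule) whose objects are the natural numbers, with $m\otimes n=m+n$; the $(m,n)$-component has $m$ outputs and $n$ inputs. For a homomorphism of PROPs $\beta:\mathsf P\to\mathsf Q$, let $Der(\mathsf P,\mathsf Q_\beta)=\{Der^d\}_{d\in\mathbb Z}$ be the graded vector space whose degree $d$ part consists of the degree $d$ maps of $\Sigma$-bimodules $\theta:\mathsf P\to\mathsf Q$ such that $\theta(f\cdot g)=\theta(f)\cdot\beta(g)+(-1)^{d|f|}\beta(f)\cdot\theta(g)$ for both the vertical and the horizontal composition. For $\Sigma$-bimodules $A,B$, $Lin_{\Sigma\text{-}\Sigma}(A,B)$ denotes the graded vector space of linear bi-equivariant maps. Theorem. Let $\mathsf M=\mathsf F(E)$ be the free PROP on a graded $\Sigma$-bimodule $E$, let $\mathcal E$ be an arbitrary graded PROP, and let $\mathsf M*\mathcal E$ be the coproduct of PROPs, considered as an $\mathsf M$-module through the canonical homomorphism $i_{\mathsf M}:\mathsf M\to\mathsf M*\mathcal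 E$. (a) Restriction to the generators is an isomorphism $Der(\mathsf M,\mathsf M*\mathcal E)\cong Lin_{\Sigma\text{-}\Sigma}(E,\mathsf M*\mathcal E)$ in each degree; denote its inverse by $Ex$. Restriction to $\mathsf M$ is an isomorphism, in each degree, from the space of derivations of $\mathsf M*\mathcal E$ (into itself) that vanish on $\mathcal E$ onto $Der(\mathsf M,\mathsf M*\mathcal E)$; denote its inverse by $\phi\mapsto\widetilde\phi$. (b) The formula $\theta\diamond\phi:=(-1)^{|\theta||\phi|}\,Ex(\widetilde\phi\circ\theta|_E)$ defines a degree $0$ bilinear product that makes $Der(\mathsf M,\mathsf M*\mathcal E)$ a graded pre-Lie algebra: the associator $A(\theta,\phi,\psi)=(\theta\diamond\phi)\diamond\psi-\theta\diamond(\phi\diamond\psi)$ satisfies $A(\theta,\phi,\psi)=(-1)^{|\phi||\psi|}A(\theta,\psi,\phi)$ for all homogeneous $\theta,\phi,\psi$. (c) This structure is natural: let $g:E\to E'$ be a degree $0$ morphism of $\Sigma$-bimodules, $f:\mathcal E\to\mathcal E'$ a homomorphism of PROPs, and $\mathsf M'=\mathsf F(E')$. If $\theta,\phi\in Der(\mathsf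 M,\mathsf M*\mathcal E)$ and $\theta',\phi'\in Der(\mathsf M',\mathsf M'*\mathcal E')$ are homogeneous with $|\theta|=|\theta'|$, $|\phi|=|\phi'|$, $(\mathsf F(g)*f)\circ\theta=\theta'\circ\mathsf F(g)$ and $(\mathsf F(g)*f)\circ\phi=\phi'\circ\mathsf F(g)$, then $(\mathsf F(g)*f)\circ(\theta\diamond\phi)=(\theta'\diamond\phi')\circ\mathsf F(g)$. -/

import Mathlib

universe u v w v₁ v₂ v₃ v₄

namespace Markl

open Equiv (Perm)

/-- The Koszul sign `(-1)^n` as a scalar. -/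
def ksign (k : Type u) [Field k] (n : ℤ) : k := ((n.negOnePow : ℤ) : k)

/-- The block sum `σ ⊕ τ` of two permutations. -/
def blockSum {m n : ℕ} (σ : Perm (Fin m)) (τ : Perm (Fin n)) : Perm (Fin (m + n)) :=
  finSumFinEquiv.permCongr (Equiv.sumCongr σ τ)

/-- The block transposition: it moves the first `m` letters behind the last `n` letters. -/
def blockSwap (m n : ℕ) : Perm (Fin (m + n)) :=
  finAddFlip.trans (finCongr (Nat.add_comm n m))

/-! ### Graded Σ-bimodules -/

/-- A graded `Σ`-bimodule over `k`: a family `E(m,n)_d` of vector spaces (`d` is the degree),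
each with commuting linear actions of `Σ_m` from the left and of `Σ_n` from the right;
`act σ τ x` is `σ x τ`. -/
structure GrBimod (k : Type u) [Field k] where
  obj : ℕ → ℕ → ℤ → Type v
  [addCommGroup : ∀ m n d, AddCommGroup (obj m n d)]
  [module : ∀ m n d, Module k (obj m n d)]
  act : ∀ {m n : ℕ} {d : ℤ}, Perm (Fin m) → Perm (Fin n) → (obj m n d →ₗ[k] obj m n d)
  act_one : ∀ {m n : ℕ} {d : ℤ} (x : obj m n d), act 1 1 x = x
  act_mul : ∀ {m n : ℕ} {d : ℤ} (σ σ' : Perm (Fin m)) (τ τ' : Perm (Fin n)) (x : obj m n d),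
    act (σ * σ') (τ' * τ) x = act σ τ (act σ' τ' x)

attribute [instance] GrBimod.addCommGroup GrBimod.module

/-- Degree `0` morphisms of graded `Σ`-bimodules. -/
structure GrBimodHom {k : Type u} [Field k] (E : GrBimod.{u, v} k) (E' : GrBimod.{u, w} k) where
  map : ∀ {m n : ℕ} {d : ℤ}, E.obj m n d →ₗ[k] E'.obj m n d
  map_act : ∀ {m n : ℕ} {d : ℤ} (σ : Perm (Fin m)) (τ : Perm (Fin n)) (x : E.obj m n d),
    map (E.act σ τ x) = E'.act σ τ (map x)

/-! ### Graded PROPs -/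

/-- A graded `k`-linear PROP: a strict symmetric monoidal category enriched in graded vector spaces
whose objects are the natural numbers, with `m ⊗ n = m + n`.  `obj m n d` is the degree `d` part of
the space of morphisms with `m` outputs and `n` inputs, `vcomp` is the vertical composition
`f ∘ g`, `hcomp` is the horizontal composition `f ⊗ g`, and `perm σ` is the morphism given by the
permutation `σ`.  Arities and degrees of composites are given up to a proof of equality,
so that no transport is needed in the axioms. -/
structure GrPROP (k : Type u) [Field k] where
  obj : ℕ → ℕ → ℤ → Type v
  [addCommGroup : ∀ m n d, AddCommGroup (obj m n d)]
  [module : ∀ m n d, Module k (obj m n d)]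
  perm : ∀ {n : ℕ}, Perm (Fin n) → obj n n 0
  vcomp : ∀ {m l n : ℕ} {a b c : ℤ}, a + b = c →
    (obj m l a →ₗ[k] obj l n b →ₗ[k] obj m n c)
  hcomp : ∀ {m m' M n n' N : ℕ} {a b c : ℤ}, m + m' = M → n + n' = N → a + b = c →
    (obj m n a →ₗ[k] obj m' n' b →ₗ[k] obj M N c)
  perm_mul : ∀ {n : ℕ} (σ τ : Perm (Fin n)),
    perm (σ * τ) = vcomp (add_zero 0) (perm σ) (perm τ)
  one_vcomp : ∀ {m n : ℕ} {a : ℤ} (f : obj m n a), vcomp (zero_add a) (perm 1) f = f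
  vcomp_one : ∀ {m n : ℕ} {a : ℤ} (f : obj m n a), vcomp (add_zero a) f (perm 1) = f
  vcomp_assoc : ∀ {m l p n : ℕ} {a b c ab bc abc : ℤ} (h₁ : a + b = ab) (h₂ : ab + c = abc)
    (h₃ : b + c = bc) (h₄ : a + bc = abc) (f : obj m l a) (g : obj l p b) (h : obj p n c),
    vcomp h₂ (vcomp h₁ f g) h = vcomp h₄ f (vcomp h₃ g h)
  hcomp_assoc : ∀ {m₁ m₂ m₃ m₁₂ m₂₃ m n₁ n₂ n₃ n₁₂ n₂₃ n : ℕ} {a b c ab bc abc : ℤ}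
    (i₁ : m₁ + m₂ = m₁₂) (i₂ : m₁₂ + m₃ = m) (i₃ : m₂ + m₃ = m₂₃) (i₄ : m₁ + m₂₃ = m)
    (j₁ : n₁ + n₂ = n₁₂) (j₂ : n₁₂ + n₃ = n) (j₃ : n₂ + n₃ = n₂₃) (j₄ : n₁ + n₂₃ = n)
    (h₁ : a + b = ab) (h₂ : ab + c = abc) (h₃ : b + c = bc) (h₄ : a + bc = abc)
    (f : obj m₁ n₁ a) (g : obj m₂ n₂ b) (h : obj m₃ n₃ c),
    hcomp i₂ j₂ h₂ (hcomp i₁ j₁ h₁ f g) h = hcomp i₄ j₄ h₄ f (hcomp i₃ j₃ h₃ g h)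
  unit_hcomp : ∀ {m n : ℕ} {a : ℤ} (f : obj m n a),
    hcomp (Nat.zero_add m) (Nat.zero_add n) (zero_add a) (perm (1 : Perm (Fin 0))) f = f
  hcomp_unit : ∀ {m n : ℕ} {a : ℤ} (f : obj m n a),
    hcomp (Nat.add_zero m) (Nat.add_zero n) (add_zero a) f (perm (1 : Perm (Fin 0))) = f
  perm_hcomp : ∀ {m n : ℕ} (σ : Perm (Fin m)) (τ : Perm (Fin n)),
    hcomp rfl rfl (add_zero 0) (perm σ) (perm τ) = perm (blockSum σ τ)
  /-- `(f ⊗ g) ∘ (f' ⊗ g') = (-1)^{|g||f'|} (f ∘ f') ⊗ (g ∘ g')` -/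
  interchange : ∀ {m m' M l l' L n n' N : ℕ} {a b a' b' ab ab' aa bb c : ℤ}
    (hM : m + m' = M) (hL : l + l' = L) (hN : n + n' = N)
    (h₁ : a + b = ab) (h₂ : a' + b' = ab') (h₃ : ab + ab' = c)
    (h₄ : a + a' = aa) (h₅ : b + b' = bb) (h₆ : aa + bb = c)
    (f : obj m l a) (g : obj m' l' b) (f' : obj l n a') (g' : obj l' n' b'),
    vcomp h₃ (hcomp hM hL h₁ f g) (hcomp hL hN h₂ f' g')
      = ksign k (b * a') • hcomp hM hN h₆ (vcomp h₄ f f') (vcomp h₅ g g')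
  /-- `β ∘ (f ⊗ g) = (-1)^{|f||g|} (g ⊗ f) ∘ β` for the block transpositions `β` -/
  swap : ∀ {m m' n n' : ℕ} {a b c : ℤ} (h : a + b = c) (h' : b + a = c)
    (f : obj m n a) (g : obj m' n' b),
    vcomp (zero_add c) (perm (blockSwap m m')) (hcomp rfl rfl h f g)
      = ksign k (a * b) • vcomp (add_zero c)
          (hcomp (Nat.add_comm m' m) (Nat.add_comm n' n) h' g f) (perm (blockSwap n n'))

attribute [instance] GrPROP.addCommGroup GrPROP.module

/-- Homomorphisms of graded PROPs. -/
structure PROPHom {k : Type u} [Field k] (P : GrPROP.{u, v} k) (Q : GrPROP.{u, w} k) where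
  map : ∀ {m n : ℕ} {d : ℤ}, P.obj m n d →ₗ[k] Q.obj m n d
  map_perm : ∀ {n : ℕ} (σ : Perm (Fin n)), map (P.perm σ) = Q.perm σ
  map_vcomp : ∀ {m l n : ℕ} {a b c : ℤ} (h : a + b = c) (f : P.obj m l a) (g : P.obj l n b),
    map (P.vcomp h f g) = Q.vcomp h (map f) (map g)
  map_hcomp : ∀ {m m' M n n' N : ℕ} {a b c : ℤ} (hm : m + m' = M) (hn : n + n' = N)
    (h : a + b = c) (f : P.obj m n a) (g : P.obj m' n' b),
    map (P.hcomp hm hn h f g) = Q.hcomp hm hn h (map f) (map g)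

section Basic

variable {k : Type u} [Field k]

/-- The identity homomorphism. -/
def PROPHom.id (P : GrPROP.{u, v} k) : PROPHom P P where
  map := LinearMap.id
  map_perm _ := rfl
  map_vcomp _ _ _ := rfl
  map_hcomp _ _ _ _ _ := rfl

/-- The composite `β ∘ α`. -/
def PROPHom.comp {P : GrPROP.{u, v₁} k} {Q : GrPROP.{u, v₂} k} {R : GrPROP.{u, v₃} k}
    (β : PROPHom Q R) (α : PROPHom P Q) : PROPHom P R where
  map := β.map ∘ₗ α.map
  map_perm σ := by simp [α.map_perm, β.map_perm]
  map_vcomp h f g := by simp [α.map_vcomp, β.map_vcomp]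
  map_hcomp hm hn h f g := by simp [α.map_hcomp, β.map_hcomp]

/-- The `Σ`-bimodule underlying a PROP: `σ f τ` is the composite `σ ∘ f ∘ τ`. -/
abbrev GrPROP.toBimod (P : GrPROP.{u, v} k) : GrBimod.{u, v} k where
  obj := P.obj
  act {_ _ d} σ τ := (P.vcomp (add_zero d)).flip (P.perm τ) ∘ₗ P.vcomp (zero_add d) (P.perm σ)
  act_one x := by simp [P.one_vcomp, P.vcomp_one]
  act_mul {m n d} σ σ' τ τ' x := by
    simp only [LinearMap.comp_apply, LinearMap.flip_apply, P.perm_mul]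
    rw [P.vcomp_assoc (add_zero 0) (zero_add d) (zero_add d) (zero_add d),
      ← P.vcomp_assoc (zero_add d) (add_zero d) (add_zero d) (zero_add d),
      ← P.vcomp_assoc (add_zero d) (add_zero d) (add_zero 0) (add_zero d),
      P.vcomp_assoc (zero_add d) (add_zero d) (add_zero d) (zero_add d)]

theorem PROPHom.map_act {P : GrPROP.{u, v} k} {Q : GrPROP.{u, w} k} (α : PROPHom P Q)
    {m n : ℕ} {d : ℤ} (σ : Perm (Fin m)) (τ : Perm (Fin n)) (f : P.obj m n d) :
    α.map (P.toBimod.act σ τ f) = Q.toBimod.act σ τ (α.map f) := by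
  change α.map (P.vcomp _ (P.vcomp _ (P.perm σ) f) (P.perm τ)) =
    Q.vcomp _ (Q.vcomp _ (Q.perm σ) (α.map f)) (Q.perm τ)
  simp only [α.map_vcomp, α.map_perm]

end Basic

/-! ### PROPs given by generators and relations -/

/-- Formal PROP expressions in generators `X`. -/
inductive Term (k : Type u) (X : ℕ → ℕ → ℤ → Type v) : ℕ → ℕ → ℤ → Type (max u v)
  | gen {m n : ℕ} {d : ℤ} (x : X m n d) : Term k X m n d
  | perm {n : ℕ} (σ : Perm (Fin n)) : Term k X n n 0
  | vcomp {m l n : ℕ} {a b c : ℤ} (h : a + b = c) (s : Term k X m l a) (t : Term k X l n b) :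
      Term k X m n c
  | hcomp {m m' M n n' N : ℕ} {a b c : ℤ} (hm : m + m' = M) (hn : n + n' = N) (h : a + b = c)
      (s : Term k X m n a) (t : Term k X m' n' b) : Term k X M N c
  | zero {m n : ℕ} {d : ℤ} : Term k X m n d
  | add {m n : ℕ} {d : ℤ} (s t : Term k X m n d) : Term k X m n d
  | smul {m n : ℕ} {d : ℤ} (r : k) (t : Term k X m n d) : Term k X m n d

/-- The smallest congruence on formal expressions which contains `R` and for which the quotient is
a graded PROP. -/
inductive Cong {k : Type u} [Field k] {X : ℕ → ℕ → ℤ → Type v}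
    (R : ∀ (m n : ℕ) (d : ℤ), Term k X m n d → Term k X m n d → Prop) :
    ∀ {m n : ℕ} {d : ℤ}, Term k X m n d → Term k X m n d → Prop
  | rel {m n : ℕ} {d : ℤ} {s t : Term k X m n d} : R m n d s t → Cong R s t
  | refl {m n : ℕ} {d : ℤ} (t : Term k X m n d) : Cong R t t
  | symm {m n : ℕ} {d : ℤ} {s t : Term k X m n d} : Cong R s t → Cong R t s
  | trans {m n : ℕ} {d : ℤ} {s t r : Term k X m n d} : Cong R s t → Cong R t r → Cong R s r
  -- compatibility with the operations
  | vcomp_congr {m l n : ℕ} {a b c : ℤ} (h : a + b = c) {s s' : Term k X m l a}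
      {t t' : Term k X l n b} : Cong R s s' → Cong R t t' →
      Cong R (.vcomp h s t) (.vcomp h s' t')
  | hcomp_congr {m m' M n n' N : ℕ} {a b c : ℤ} (hm : m + m' = M) (hn : n + n' = N)
      (h : a + b = c) {s s' : Term k X m n a} {t t' : Term k X m' n' b} :
      Cong R s s' → Cong R t t' → Cong R (.hcomp hm hn h s t) (.hcomp hm hn h s' t')
  | add_congr {m n : ℕ} {d : ℤ} {s s' t t' : Term k X m n d} :
      Cong R s s' → Cong R t t' → Cong R (.add s t) (.add s' t')
  | smul_congr {m n : ℕ} {d : ℤ} (r : k) {t t' : Term k X m n d} :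
      Cong R t t' → Cong R (.smul r t) (.smul r t')
  -- the axioms of vector spaces
  | add_assoc {m n : ℕ} {d : ℤ} (s t r : Term k X m n d) :
      Cong R (.add (.add s t) r) (.add s (.add t r))
  | add_comm {m n : ℕ} {d : ℤ} (s t : Term k X m n d) : Cong R (.add s t) (.add t s)
  | zero_add {m n : ℕ} {d : ℤ} (t : Term k X m n d) : Cong R (.add .zero t) t
  | neg_add {m n : ℕ} {d : ℤ} (t : Term k X m n d) : Cong R (.add (.smul (-1) t) t) .zero
  | smul_add {m n : ℕ} {d : ℤ} (r : k) (s t : Term k X m n d) :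
      Cong R (.smul r (.add s t)) (.add (.smul r s) (.smul r t))
  | add_smul {m n : ℕ} {d : ℤ} (r r' : k) (t : Term k X m n d) :
      Cong R (.smul (r + r') t) (.add (.smul r t) (.smul r' t))
  | mul_smul {m n : ℕ} {d : ℤ} (r r' : k) (t : Term k X m n d) :
      Cong R (.smul (r * r') t) (.smul r (.smul r' t))
  | one_smul {m n : ℕ} {d : ℤ} (t : Term k X m n d) : Cong R (.smul 1 t) t
  -- bilinearity of the compositions
  | vcomp_add_left {m l n : ℕ} {a b c : ℤ} (h : a + b = c) (s s' : Term k X m l a)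
      (t : Term k X l n b) :
      Cong R (.vcomp h (.add s s') t) (.add (.vcomp h s t) (.vcomp h s' t))
  | vcomp_add_right {m l n : ℕ} {a b c : ℤ} (h : a + b = c) (s : Term k X m l a)
      (t t' : Term k X l n b) :
      Cong R (.vcomp h s (.add t t')) (.add (.vcomp h s t) (.vcomp h s t'))
  | vcomp_smul_left {m l n : ℕ} {a b c : ℤ} (h : a + b = c) (r : k) (s : Term k X m l a)
      (t : Term k X l n b) : Cong R (.vcomp h (.smul r s) t) (.smul r (.vcomp h s t))
  | vcomp_smul_right {m l n : ℕ} {a b c : ℤ} (h : a + b = c) (r : k) (s : Term k X m l a)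
      (t : Term k X l n b) : Cong R (.vcomp h s (.smul r t)) (.smul r (.vcomp h s t))
  | hcomp_add_left {m m' M n n' N : ℕ} {a b c : ℤ} (hm : m + m' = M) (hn : n + n' = N)
      (h : a + b = c) (s s' : Term k X m n a) (t : Term k X m' n' b) :
      Cong R (.hcomp hm hn h (.add s s') t) (.add (.hcomp hm hn h s t) (.hcomp hm hn h s' t))
  | hcomp_add_right {m m' M n n' N : ℕ} {a b c : ℤ} (hm : m + m' = M) (hn : n + n' = N)
      (h : a + b = c) (s : Term k X m n a) (t t' : Term k X m' n' b) :
      Cong R (.hcomp hm hn h s (.add t t')) (.add (.hcomp hm hn h s t) (.hcomp hm hn h s t'))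
  | hcomp_smul_left {m m' M n n' N : ℕ} {a b c : ℤ} (hm : m + m' = M) (hn : n + n' = N)
      (h : a + b = c) (r : k) (s : Term k X m n a) (t : Term k X m' n' b) :
      Cong R (.hcomp hm hn h (.smul r s) t) (.smul r (.hcomp hm hn h s t))
  | hcomp_smul_right {m m' M n n' N : ℕ} {a b c : ℤ} (hm : m + m' = M) (hn : n + n' = N)
      (h : a + b = c) (r : k) (s : Term k X m n a) (t : Term k X m' n' b) :
      Cong R (.hcomp hm hn h s (.smul r t)) (.smul r (.hcomp hm hn h s t))
  -- the axioms of PROPs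
  | perm_mul {n : ℕ} (σ τ : Perm (Fin n)) :
      Cong R (.perm (σ * τ)) (.vcomp (_root_.add_zero 0) (.perm σ) (.perm τ))
  | one_vcomp {m n : ℕ} {a : ℤ} (f : Term k X m n a) :
      Cong R (.vcomp (_root_.zero_add a) (.perm 1) f) f
  | vcomp_one {m n : ℕ} {a : ℤ} (f : Term k X m n a) :
      Cong R (.vcomp (_root_.add_zero a) f (.perm 1)) f
  | vcomp_assoc {m l p n : ℕ} {a b c ab bc abc : ℤ} (h₁ : a + b = ab) (h₂ : ab + c = abc)
      (h₃ : b + c = bc) (h₄ : a + bc = abc)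
      (f : Term k X m l a) (g : Term k X l p b) (h : Term k X p n c) :
      Cong R (.vcomp h₂ (.vcomp h₁ f g) h) (.vcomp h₄ f (.vcomp h₃ g h))
  | hcomp_assoc {m₁ m₂ m₃ m₁₂ m₂₃ m n₁ n₂ n₃ n₁₂ n₂₃ n : ℕ} {a b c ab bc abc : ℤ}
      (i₁ : m₁ + m₂ = m₁₂) (i₂ : m₁₂ + m₃ = m) (i₃ : m₂ + m₃ = m₂₃) (i₄ : m₁ + m₂₃ = m)
      (j₁ : n₁ + n₂ = n₁₂) (j₂ : n₁₂ + n₃ = n) (j₃ : n₂ + n₃ = n₂₃) (j₄ : n₁ + n₂₃ = n)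
      (h₁ : a + b = ab) (h₂ : ab + c = abc) (h₃ : b + c = bc) (h₄ : a + bc = abc)
      (f : Term k X m₁ n₁ a) (g : Term k X m₂ n₂ b) (h : Term k X m₃ n₃ c) :
      Cong R (.hcomp i₂ j₂ h₂ (.hcomp i₁ j₁ h₁ f g) h) (.hcomp i₄ j₄ h₄ f (.hcomp i₃ j₃ h₃ g h))
  | unit_hcomp {m n : ℕ} {a : ℤ} (f : Term k X m n a) :
      Cong R (.hcomp (Nat.zero_add m) (Nat.zero_add n) (_root_.zero_add a)
        (.perm (1 : Perm (Fin 0))) f) f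
  | hcomp_unit {m n : ℕ} {a : ℤ} (f : Term k X m n a) :
      Cong R (.hcomp (Nat.add_zero m) (Nat.add_zero n) (_root_.add_zero a) f
        (.perm (1 : Perm (Fin 0)))) f
  | perm_hcomp {m n : ℕ} (σ : Perm (Fin m)) (τ : Perm (Fin n)) :
      Cong R (.hcomp rfl rfl (_root_.add_zero 0) (.perm σ) (.perm τ)) (.perm (blockSum σ τ))
  | interchange {m m' M l l' L n n' N : ℕ} {a b a' b' ab ab' aa bb c : ℤ}
      (hM : m + m' = M) (hL : l + l' = L) (hN : n + n' = N)
      (h₁ : a + b = ab) (h₂ : a' + b' = ab') (h₃ : ab + ab' = c)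
      (h₄ : a + a' = aa) (h₅ : b + b' = bb) (h₆ : aa + bb = c)
      (f : Term k X m l a) (g : Term k X m' l' b) (f' : Term k X l n a') (g' : Term k X l' n' b') :
      Cong R (.vcomp h₃ (.hcomp hM hL h₁ f g) (.hcomp hL hN h₂ f' g'))
        (.smul (ksign k (b * a')) (.hcomp hM hN h₆ (.vcomp h₄ f f') (.vcomp h₅ g g')))
  | swap {m m' n n' : ℕ} {a b c : ℤ} (h : a + b = c) (h' : b + a = c)
      (f : Term k X m n a) (g : Term k X m' n' b) :
      Cong R (.vcomp (_root_.zero_add c) (.perm (blockSwap m m')) (.hcomp rfl rfl h f g))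
        (.smul (ksign k (a * b)) (.vcomp (_root_.add_zero c)
          (.hcomp (Nat.add_comm m' m) (Nat.add_comm n' n) h' g f) (.perm (blockSwap n n'))))

section Presented

variable {k : Type u} [Field k] {X : ℕ → ℕ → ℤ → Type v}
  (R : ∀ (m n : ℕ) (d : ℤ), Term k X m n d → Term k X m n d → Prop)

/-- The congruence generated by `R`, as a setoid. -/
def congSetoid (m n : ℕ) (d : ℤ) : Setoid (Term k X m n d) where
  r := Cong R
  iseqv := ⟨.refl, .symm, .trans⟩

/-- The components of the PROP generated by `X` with relations `R`. -/
def PresObj (m n : ℕ) (d : ℤ) : Type (max u v) := Quotient (congSetoid R m n d)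

/-- The class of a formal expression. -/
def PresObj.mk {m n : ℕ} {d : ℤ} (t : Term k X m n d) : PresObj R m n d :=
  Quotient.mk (congSetoid R m n d) t

theorem PresObj.sound {R : ∀ (m n : ℕ) (d : ℤ), Term k X m n d → Term k X m n d → Prop}
    {m n : ℕ} {d : ℤ} {s t : Term k X m n d} (h : Cong R s t) :
    PresObj.mk R s = PresObj.mk R t :=
  Quotient.sound h

instance (m n : ℕ) (d : ℤ) : AddCommGroup (PresObj R m n d) where
  zero := PresObj.mk R .zero
  add := Quotient.map₂ Term.add fun _ _ h _ _ h' => Cong.add_congr h h'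
  neg := Quotient.map (Term.smul (-1)) fun _ _ h => Cong.smul_congr _ h
  nsmul := @nsmulRec _ ⟨PresObj.mk R .zero⟩
    ⟨Quotient.map₂ Term.add fun _ _ h _ _ h' => Cong.add_congr h h'⟩
  zsmul := @zsmulRec _ ⟨PresObj.mk R .zero⟩
    ⟨Quotient.map₂ Term.add fun _ _ h _ _ h' => Cong.add_congr h h'⟩
    ⟨Quotient.map (Term.smul (-1)) fun _ _ h => Cong.smul_congr _ h⟩
    (@nsmulRec _ ⟨PresObj.mk R .zero⟩
      ⟨Quotient.map₂ Term.add fun _ _ h _ _ h' => Cong.add_congr h h'⟩)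
  add_assoc := by rintro ⟨a⟩ ⟨b⟩ ⟨c⟩; exact PresObj.sound (.add_assoc a b c)
  zero_add := by rintro ⟨a⟩; exact PresObj.sound (.zero_add a)
  add_zero := by rintro ⟨a⟩; exact PresObj.sound (.trans (.add_comm a _) (.zero_add a))
  add_comm := by rintro ⟨a⟩ ⟨b⟩; exact PresObj.sound (.add_comm a b)
  neg_add_cancel := by rintro ⟨a⟩; exact PresObj.sound (.neg_add a)

instance (m n : ℕ) (d : ℤ) : SMul k (PresObj R m n d) :=
  ⟨fun r => Quotient.map (Term.smul r) fun _ _ h => Cong.smul_congr r h⟩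

instance (m n : ℕ) (d : ℤ) : Module k (PresObj R m n d) :=
  Module.ofMinimalAxioms
    (by rintro r ⟨a⟩ ⟨b⟩; exact PresObj.sound (.smul_add r a b))
    (by rintro r r' ⟨a⟩; exact PresObj.sound (.add_smul r r' a))
    (by rintro r r' ⟨a⟩; exact PresObj.sound (.mul_smul r r' a))
    (by rintro ⟨a⟩; exact PresObj.sound (.one_smul a))

/-- The graded PROP generated by `X` with relations `R`. -/
def presented : GrPROP.{u, max u v} k where
  obj := PresObj R
  perm σ := PresObj.mk R (.perm σ)
  vcomp h := LinearMap.mk₂ k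
    (Quotient.map₂ (Term.vcomp h) fun _ _ h₁ _ _ h₂ => Cong.vcomp_congr h h₁ h₂)
    (by rintro ⟨a⟩ ⟨b⟩ ⟨c⟩; exact PresObj.sound (.vcomp_add_left h a b c))
    (by rintro r ⟨a⟩ ⟨b⟩; exact PresObj.sound (.vcomp_smul_left h r a b))
    (by rintro ⟨a⟩ ⟨b⟩ ⟨c⟩; exact PresObj.sound (.vcomp_add_right h a b c))
    (by rintro r ⟨a⟩ ⟨b⟩; exact PresObj.sound (.vcomp_smul_right h r a b))
  hcomp hm hn h := LinearMap.mk₂ k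
    (Quotient.map₂ (Term.hcomp hm hn h) fun _ _ h₁ _ _ h₂ => Cong.hcomp_congr hm hn h h₁ h₂)
    (by rintro ⟨a⟩ ⟨b⟩ ⟨c⟩; exact PresObj.sound (.hcomp_add_left hm hn h a b c))
    (by rintro r ⟨a⟩ ⟨b⟩; exact PresObj.sound (.hcomp_smul_left hm hn h r a b))
    (by rintro ⟨a⟩ ⟨b⟩ ⟨c⟩; exact PresObj.sound (.hcomp_add_right hm hn h a b c))
    (by rintro r ⟨a⟩ ⟨b⟩; exact PresObj.sound (.hcomp_smul_right hm hn h r a b))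
  perm_mul σ τ := PresObj.sound (.perm_mul σ τ)
  one_vcomp := by rintro _ _ _ ⟨f⟩; exact PresObj.sound (.one_vcomp f)
  vcomp_one := by rintro _ _ _ ⟨f⟩; exact PresObj.sound (.vcomp_one f)
  vcomp_assoc h₁ h₂ h₃ h₄ := by
    rintro ⟨f⟩ ⟨g⟩ ⟨h⟩; exact PresObj.sound (.vcomp_assoc h₁ h₂ h₃ h₄ f g h)
  hcomp_assoc i₁ i₂ i₃ i₄ j₁ j₂ j₃ j₄ h₁ h₂ h₃ h₄ := by
    rintro ⟨f⟩ ⟨g⟩ ⟨h⟩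
    exact PresObj.sound (.hcomp_assoc i₁ i₂ i₃ i₄ j₁ j₂ j₃ j₄ h₁ h₂ h₃ h₄ f g h)
  unit_hcomp := by rintro _ _ _ ⟨f⟩; exact PresObj.sound (.unit_hcomp f)
  hcomp_unit := by rintro _ _ _ ⟨f⟩; exact PresObj.sound (.hcomp_unit f)
  perm_hcomp σ τ := PresObj.sound (.perm_hcomp σ τ)
  interchange hM hL hN h₁ h₂ h₃ h₄ h₅ h₆ := by
    rintro ⟨f⟩ ⟨g⟩ ⟨f'⟩ ⟨g'⟩
    exact PresObj.sound (.interchange hM hL hN h₁ h₂ h₃ h₄ h₅ h₆ f g f' g')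
  swap h h' := by rintro ⟨f⟩ ⟨g⟩; exact PresObj.sound (.swap h h' f g)

/-- The value of a formal expression in a PROP `Q`, for given values of the generators. -/
def Term.eval (Q : GrPROP.{u, w} k) (j : ∀ {m n : ℕ} {d : ℤ}, X m n d → Q.obj m n d) :
    ∀ {m n : ℕ} {d : ℤ}, Term k X m n d → Q.obj m n d
  | _, _, _, .gen x => j x
  | _, _, _, .perm σ => Q.perm σ
  | _, _, _, .vcomp h s t => Q.vcomp h (s.eval Q j) (t.eval Q j)
  | _, _, _, .hcomp hm hn h s t => Q.hcomp hm hn h (s.eval Q j) (t.eval Q j)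
  | _, _, _, .zero => 0
  | _, _, _, .add s t => s.eval Q j + t.eval Q j
  | _, _, _, .smul r t => r • t.eval Q j

theorem Cong.eval_eq {R : ∀ (m n : ℕ) (d : ℤ), Term k X m n d → Term k X m n d → Prop}
    (Q : GrPROP.{u, w} k) (j : ∀ {m n : ℕ} {d : ℤ}, X m n d → Q.obj m n d)
    (hj : ∀ {m n : ℕ} {d : ℤ} {s t : Term k X m n d}, R m n d s t → s.eval Q j = t.eval Q j)
    {m n : ℕ} {d : ℤ} {s t : Term k X m n d} (h : Cong R s t) : s.eval Q j = t.eval Q j := by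
  induction h with
  | rel h => exact hj h
  | refl => rfl
  | symm _ ih => exact ih.symm
  | trans _ _ ih ih' => exact ih.trans ih'
  | vcomp_congr _ _ _ ih ih' => simp only [Term.eval, ih, ih']
  | hcomp_congr _ _ _ _ _ ih ih' => simp only [Term.eval, ih, ih']
  | add_congr _ _ ih ih' => simp only [Term.eval, ih, ih']
  | smul_congr _ _ ih => simp only [Term.eval, ih]
  | add_assoc => exact _root_.add_assoc _ _ _
  | add_comm => exact _root_.add_comm _ _
  | zero_add => exact _root_.zero_add _
  | neg_add => simp [Term.eval]
  | smul_add => exact _root_.smul_add _ _ _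
  | add_smul => exact _root_.add_smul _ _ _
  | mul_smul => exact SemigroupAction.mul_smul _ _ _
  | one_smul => exact _root_.one_smul _ _
  | vcomp_add_left => simp [Term.eval]
  | vcomp_add_right => simp [Term.eval]
  | vcomp_smul_left => simp [Term.eval]
  | vcomp_smul_right => simp [Term.eval]
  | hcomp_add_left => simp [Term.eval]
  | hcomp_add_right => simp [Term.eval]
  | hcomp_smul_left => simp [Term.eval]
  | hcomp_smul_right => simp [Term.eval]
  | perm_mul => exact Q.perm_mul _ _
  | one_vcomp => exact Q.one_vcomp _
  | vcomp_one => exact Q.vcomp_one _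
  | vcomp_assoc => exact Q.vcomp_assoc _ _ _ _ _ _ _
  | hcomp_assoc => exact Q.hcomp_assoc _ _ _ _ _ _ _ _ _ _ _ _ _ _ _
  | unit_hcomp => exact Q.unit_hcomp _
  | hcomp_unit => exact Q.hcomp_unit _
  | perm_hcomp => exact Q.perm_hcomp _ _
  | interchange => exact Q.interchange _ _ _ _ _ _ _ _ _ _ _ _ _
  | swap => exact Q.swap _ _ _ _

/-- The homomorphism out of a presented PROP with given values on the generators. -/
def presLift (Q : GrPROP.{u, w} k) (j : ∀ {m n : ℕ} {d : ℤ}, X m n d → Q.obj m n d)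
    (hj : ∀ {m n : ℕ} {d : ℤ} {s t : Term k X m n d}, R m n d s t → s.eval Q j = t.eval Q j) :
    PROPHom (presented R) Q where
  map {m n d} :=
    { toFun := Quotient.lift (Term.eval Q j) fun _ _ h => Cong.eval_eq Q j hj h
      map_add' := by rintro ⟨a⟩ ⟨b⟩; rfl
      map_smul' := by rintro r ⟨a⟩; rfl }
  map_perm _ := rfl
  map_vcomp _ := by rintro ⟨f⟩ ⟨g⟩; rfl
  map_hcomp _ _ _ := by rintro ⟨f⟩ ⟨g⟩; rfl

end Presented

/-! ### Free PROPs -/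

section Free

variable {k : Type u} [Field k]

/-- The relations of the free PROP: the inclusion of generators is linear and bi-equivariant. -/
inductive FreeRel (E : GrBimod.{u, v} k) :
    ∀ (m n : ℕ) (d : ℤ), Term k E.obj m n d → Term k E.obj m n d → Prop
  | add {m n : ℕ} {d : ℤ} (x y : E.obj m n d) :
      FreeRel E _ _ _ (.gen (x + y)) (.add (.gen x) (.gen y))
  | smul {m n : ℕ} {d : ℤ} (r : k) (x : E.obj m n d) :
      FreeRel E _ _ _ (.gen (r • x)) (.smul r (.gen x))
  | act {m n : ℕ} {d : ℤ} (σ : Perm (Fin m)) (τ : Perm (Fin n)) (x : E.obj m n d) :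
      FreeRel E _ _ _ (.gen (E.act σ τ x))
        (.vcomp (add_zero d) (.vcomp (zero_add d) (.perm σ) (.gen x)) (.perm τ))

/-- The free PROP `F(E)` on a graded `Σ`-bimodule `E`. -/
def freePROP (E : GrBimod.{u, v} k) : GrPROP.{u, max u v} k := presented (FreeRel E)

/-- The inclusion of the generators `E → F(E)`. -/
def freeIncl (E : GrBimod.{u, v} k) : GrBimodHom E (freePROP E).toBimod where
  map :=
    { toFun := fun x => PresObj.mk (FreeRel E) (.gen x)
      map_add' := fun x y => PresObj.sound (.rel (.add x y))
      map_smul' := fun r x => PresObj.sound (.rel (.smul r x)) }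
  map_act σ τ x := PresObj.sound (.rel (.act σ τ x))

/-- The homomorphism `F(E) → Q` extending a morphism of `Σ`-bimodules `E → Q`. -/
def freeLift {E : GrBimod.{u, v} k} (Q : GrPROP.{u, w} k) (g : GrBimodHom E Q.toBimod) :
    PROPHom (freePROP E) Q :=
  presLift (FreeRel E) Q (fun x => g.map x) (by
    intro m n d s t h
    cases h with
    | add x y => exact map_add g.map x y
    | smul r x => exact map_smul g.map r x
    | act σ τ x => exact g.map_act σ τ x)

/-- The homomorphism `F(g) : F(E) → F(E')` induced by `g : E → E'`. -/
def freeMap {E : GrBimod.{u, v} k} {E' : GrBimod.{u, w} k} (g : GrBimodHom E E') :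
    PROPHom (freePROP E) (freePROP E') :=
  freeLift (freePROP E')
    { map := (freeIncl E').map ∘ₗ g.map
      map_act := fun σ τ x => by
        simp only [LinearMap.comp_apply, g.map_act, (freeIncl E').map_act] }

end Free

/-! ### Coproducts of PROPs -/

section Coprod

variable {k : Type u} [Field k]

/-- The relations saying that `j : P → Term` becomes a homomorphism of PROPs. -/
inductive HomRel (P : GrPROP.{u, v} k) {X : ℕ → ℕ → ℤ → Type w}
    (j : ∀ {m n : ℕ} {d : ℤ}, P.obj m n d → X m n d) :
    ∀ (m n : ℕ) (d : ℤ), Term k X m n d → Term k X m n d → Prop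
  | add {m n : ℕ} {d : ℤ} (x y : P.obj m n d) :
      HomRel P j _ _ _ (.gen (j (x + y))) (.add (.gen (j x)) (.gen (j y)))
  | smul {m n : ℕ} {d : ℤ} (r : k) (x : P.obj m n d) :
      HomRel P j _ _ _ (.gen (j (r • x))) (.smul r (.gen (j x)))
  | perm {n : ℕ} (σ : Perm (Fin n)) : HomRel P j _ _ _ (.gen (j (P.perm σ))) (.perm σ)
  | vcomp {m l n : ℕ} {a b c : ℤ} (h : a + b = c) (x : P.obj m l a) (y : P.obj l n b) :
      HomRel P j _ _ _ (.gen (j (P.vcomp h x y))) (.vcomp h (.gen (j x)) (.gen (j y)))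
  | hcomp {m m' M n n' N : ℕ} {a b c : ℤ} (hm : m + m' = M) (hn : n + n' = N) (h : a + b = c)
      (x : P.obj m n a) (y : P.obj m' n' b) :
      HomRel P j _ _ _ (.gen (j (P.hcomp hm hn h x y))) (.hcomp hm hn h (.gen (j x)) (.gen (j y)))

/-- The relations of the coproduct: both inclusions are homomorphisms of PROPs. -/
def CoprodRel (P : GrPROP.{u, v} k) (Q : GrPROP.{u, w} k) (m n : ℕ) (d : ℤ)
    (s t : Term k (fun m n d => P.obj m n d ⊕ Q.obj m n d) m n d) : Prop :=
  HomRel P (fun x => Sum.inl x) m n d s t ∨ HomRel Q (fun y => Sum.inr y) m n d s t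

/-- The coproduct (free product) `P * Q` of PROPs. -/
def coprod (P : GrPROP.{u, v} k) (Q : GrPROP.{u, w} k) : GrPROP.{u, max u v w} k :=
  presented (CoprodRel P Q)

/-- The canonical homomorphism `P → P * Q`. -/
def coprodInl (P : GrPROP.{u, v} k) (Q : GrPROP.{u, w} k) : PROPHom P (coprod P Q) where
  map :=
    { toFun := fun x => PresObj.mk (CoprodRel P Q) (.gen (Sum.inl x))
      map_add' := fun x y => PresObj.sound (.rel (.inl (.add x y)))
      map_smul' := fun r x => PresObj.sound (.rel (.inl (.smul r x))) }
  map_perm σ := PresObj.sound (.rel (.inl (.perm σ)))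
  map_vcomp h x y := PresObj.sound (.rel (.inl (.vcomp h x y)))
  map_hcomp hm hn h x y := PresObj.sound (.rel (.inl (.hcomp hm hn h x y)))

/-- The canonical homomorphism `Q → P * Q`. -/
def coprodInr (P : GrPROP.{u, v} k) (Q : GrPROP.{u, w} k) : PROPHom Q (coprod P Q) where
  map :=
    { toFun := fun x => PresObj.mk (CoprodRel P Q) (.gen (Sum.inr x))
      map_add' := fun x y => PresObj.sound (.rel (.inr (.add x y)))
      map_smul' := fun r x => PresObj.sound (.rel (.inr (.smul r x))) }
  map_perm σ := PresObj.sound (.rel (.inr (.perm σ)))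
  map_vcomp h x y := PresObj.sound (.rel (.inr (.vcomp h x y)))
  map_hcomp hm hn h x y := PresObj.sound (.rel (.inr (.hcomp hm hn h x y)))

/-- The homomorphism `P * Q → S` with given restrictions to `P` and `Q`. -/
def coprodLift {P : GrPROP.{u, v₁} k} {Q : GrPROP.{u, v₂} k} {S : GrPROP.{u, v₃} k}
    (α : PROPHom P S) (β : PROPHom Q S) : PROPHom (coprod P Q) S :=
  presLift (CoprodRel P Q) S (fun x => Sum.elim (fun y => α.map y) (fun y => β.map y) x) (by
    rintro m n d s t (h | h)
    · cases h with
      | add x y => exact map_add α.map x y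
      | smul r x => exact map_smul α.map r x
      | perm σ => exact α.map_perm σ
      | vcomp h x y => exact α.map_vcomp h x y
      | hcomp hm hn h x y => exact α.map_hcomp hm hn h x y
    · cases h with
      | add x y => exact map_add β.map x y
      | smul r x => exact map_smul β.map r x
      | perm σ => exact β.map_perm σ
      | vcomp h x y => exact β.map_vcomp h x y
      | hcomp hm hn h x y => exact β.map_hcomp hm hn h x y)

/-- The homomorphism `α * β : P * Q → P' * Q'`. -/
def coprodMap {P : GrPROP.{u, v₁} k} {Q : GrPROP.{u, v₂} k} {P' : GrPROP.{u, v₃} k}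
    {Q' : GrPROP.{u, v₄} k} (α : PROPHom P P') (β : PROPHom Q Q') :
    PROPHom (coprod P Q) (coprod P' Q') :=
  coprodLift ((coprodInl P' Q').comp α) ((coprodInr P' Q').comp β)

end Coprod

/-! ### Derivations -/

section Der

variable {k : Type u} [Field k]

/-- The pairs of degrees `(a, c)` with `a + d = c`. -/
structure DegPair (d : ℤ) where
  src : ℤ
  tgt : ℤ
  eq : src + d = tgt

/-- Families of linear maps of degree `d`: for `a + d = c`, a map `A(m,n)_a → B(m,n)_c`. -/
abbrev GrMap (k : Type u) [Field k] (A : ℕ → ℕ → ℤ → Type v) (B : ℕ → ℕ → ℤ → Type w)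
    [∀ m n d, AddCommGroup (A m n d)] [∀ m n d, Module k (A m n d)]
    [∀ m n d, AddCommGroup (B m n d)] [∀ m n d, Module k (B m n d)] (d : ℤ) : Type (max v w) :=
  ∀ (m n : ℕ) (t : DegPair d), A m n t.src →ₗ[k] B m n t.tgt

/-- `Lin_{Σ-Σ}(A, B)` in degree `d`: the bi-equivariant maps of degree `d`. -/
def Lin (A : GrBimod.{u, v} k) (B : GrBimod.{u, w} k) (d : ℤ) : Submodule k (GrMap k A.obj B.obj d) where
  carrier := {F | ∀ (m n : ℕ) (a c : ℤ) (h : a + d = c) (σ : Perm (Fin m)) (τ : Perm (Fin n))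
    (x : A.obj m n a), F m n ⟨a, c, h⟩ (A.act σ τ x) = B.act σ τ (F m n ⟨a, c, h⟩ x)}
  add_mem' := by
    intro F G hF hG m n a c h σ τ x
    simp [hF m n a c h σ τ x, hG m n a c h σ τ x]
  zero_mem' := by intro m n a c h σ τ x; simp
  smul_mem' := by
    intro r F hF m n a c h σ τ x
    simp [hF m n a c h σ τ x]

/-- `θ` satisfies the degree `d` Leibniz rules for both compositions, where `Q` is a `P`-module
through the homomorphism `β : P → Q`. -/
def IsLeibniz {P : GrPROP.{u, v} k} {Q : GrPROP.{u, w} k} (β : PROPHom P Q) {d : ℤ}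
    (θ : GrMap k P.obj Q.obj d) : Prop :=
  (∀ {m l n : ℕ} {a b c a' b' c' : ℤ} (h : a + b = c) (ha : a + d = a') (hb : b + d = b')
      (hc : c + d = c') (h₁ : a' + b = c') (h₂ : a + b' = c')
      (f : P.obj m l a) (g : P.obj l n b),
    θ m n ⟨c, c', hc⟩ (P.vcomp h f g)
      = Q.vcomp h₁ (θ m l ⟨a, a', ha⟩ f) (β.map g)
        + ksign k (d * a) • Q.vcomp h₂ (β.map f) (θ l n ⟨b, b', hb⟩ g)) ∧
  (∀ {m m' M n n' N : ℕ} {a b c a' b' c' : ℤ} (hm : m + m' = M) (hn : n + n' = N)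
      (h : a + b = c) (ha : a + d = a') (hb : b + d = b')
      (hc : c + d = c') (h₁ : a' + b = c') (h₂ : a + b' = c')
      (f : P.obj m n a) (g : P.obj m' n' b),
    θ M N ⟨c, c', hc⟩ (P.hcomp hm hn h f g)
      = Q.hcomp hm hn h₁ (θ m n ⟨a, a', ha⟩ f) (β.map g)
        + ksign k (d * a) • Q.hcomp hm hn h₂ (β.map f) (θ m' n' ⟨b, b', hb⟩ g))

/-- The space `Der(P, Q_β)` of derivations of degree `d`: the maps of `Σ`-bimodules of degree `d`
that satisfy the Leibniz rules for the vertical and horizontal compositions. Here `Q_β` is `Q` with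
the `P`-module structure given by the homomorphism `β : P → Q`. -/
def Der {P : GrPROP.{u, v} k} {Q : GrPROP.{u, w} k} (β : PROPHom P Q) (d : ℤ) :
    Submodule k (GrMap k P.obj Q.obj d) where
  carrier := {θ | θ ∈ Lin P.toBimod Q.toBimod d ∧ IsLeibniz β θ}
  add_mem' := by
    rintro θ η ⟨hθ, hθv, hθh⟩ ⟨hη, hηv, hηh⟩
    refine ⟨add_mem hθ hη, ?_, ?_⟩
    · intro m l n a b c a' b' c' h ha hb hc h₁ h₂ f g
      have e₁ := hθv h ha hb hc h₁ h₂ f g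
      have e₂ := hηv h ha hb hc h₁ h₂ f g
      simp only [Pi.add_apply, LinearMap.add_apply, map_add, smul_add, e₁, e₂]
      abel
    · intro m m' M n n' N a b c a' b' c' hm hn h ha hb hc h₁ h₂ f g
      have e₁ := hθh hm hn h ha hb hc h₁ h₂ f g
      have e₂ := hηh hm hn h ha hb hc h₁ h₂ f g
      simp only [Pi.add_apply, LinearMap.add_apply, map_add, smul_add, e₁, e₂]
      abel
  zero_mem' := by
    refine ⟨zero_mem _, ?_, ?_⟩
    · intros; simp
    · intros; simp
  smul_mem' := by
    rintro r θ ⟨hθ, hθv, hθh⟩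
    refine ⟨Submodule.smul_mem _ r hθ, ?_, ?_⟩
    · intro m l n a b c a' b' c' h ha hb hc h₁ h₂ f g
      have e₁ := hθv h ha hb hc h₁ h₂ f g
      simp only [Pi.smul_apply, LinearMap.smul_apply, map_smul, smul_add, e₁]
      rw [smul_comm r]
    · intro m m' M n n' N a b c a' b' c' hm hn h ha hb hc h₁ h₂ f g
      have e₁ := hθh hm hn h ha hb hc h₁ h₂ f g
      simp only [Pi.smul_apply, LinearMap.smul_apply, map_smul, smul_add, e₁]
      rw [smul_comm r]

/-- Restriction `θ ↦ θ|_E` of derivations of `F(E)` to the generators. -/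
def restrictGen {E : GrBimod.{u, v} k} {Q : GrPROP.{u, w} k} (β : PROPHom (freePROP E) Q)
    (d : ℤ) : Der β d →ₗ[k] Lin E Q.toBimod d where
  toFun θ := ⟨fun m n t => θ.1 m n t ∘ₗ (freeIncl E).map, by
    intro m n a c h σ τ x
    have e := θ.2.1 m n a c h σ τ ((freeIncl E).map x)
    rw [← (freeIncl E).map_act] at e
    exact e⟩
  map_add' _ _ := rfl
  map_smul' _ _ := rfl

/-- The derivations of `P * Q` of degree `d` that vanish on `Q`. -/
def DerVanish (P : GrPROP.{u, v} k) (Q : GrPROP.{u, w} k) (d : ℤ) :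
    Submodule k (Der (PROPHom.id (coprod P Q)) d) where
  carrier := {θ | ∀ (m n : ℕ) (a c : ℤ) (h : a + d = c) (y : Q.obj m n a),
    θ.1 m n ⟨a, c, h⟩ ((coprodInr P Q).map y) = 0}
  add_mem' := by
    intro θ η hθ hη m n a c h y
    have e₁ := hθ m n a c h y
    have e₂ := hη m n a c h y
    simp [e₁, e₂]
  zero_mem' := by intro m n a c h y; rfl
  smul_mem' := by
    intro r θ hθ m n a c h y
    have e₁ := hθ m n a c h y
    simp [e₁]

/-- Restriction to `P` of the derivations of `P * Q` that vanish on `Q`; it takes values in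
`Der(P, P * Q)`, where `P * Q` is a `P`-module through the canonical homomorphism. -/
def restrictLeft (P : GrPROP.{u, v} k) (Q : GrPROP.{u, w} k) (d : ℤ) :
    DerVanish P Q d →ₗ[k] Der (coprodInl P Q) d where
  toFun θ := ⟨fun m n t => θ.1.1 m n t ∘ₗ (coprodInl P Q).map, by
    refine ⟨?_, ?_, ?_⟩
    · intro m n a c h σ τ x
      have e := (coprodInl P Q).map_act σ τ x
      have e' := θ.1.2.1 m n a c h σ τ ((coprodInl P Q).map x)
      rw [← e] at e'
      exact e'
    · intro m l n a b c a' b' c' h ha hb hc h₁ h₂ f g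
      have e := θ.1.2.2.1 h ha hb hc h₁ h₂ ((coprodInl P Q).map f) ((coprodInl P Q).map g)
      rw [← (coprodInl P Q).map_vcomp] at e
      exact e
    · intro m m' M n n' N a b c a' b' c' hm hn h ha hb hc h₁ h₂ f g
      have e := θ.1.2.2.2 hm hn h ha hb hc h₁ h₂ ((coprodInl P Q).map f) ((coprodInl P Q).map g)
      rw [← (coprodInl P Q).map_hcomp] at e
      exact e⟩
  map_add' _ _ := rfl
  map_smul' _ _ := rfl

/-- `Lin_{Σ-Σ}` is closed under composition; `compLin h G F` is `G ∘ F`. -/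
def compLin {A : GrBimod.{u, v₁} k} {B : GrBimod.{u, v₂} k} {C : GrBimod.{u, v₃} k}
    {p q r : ℤ} (h : p + q = r) (G : Lin B C q) (F : Lin A B p) : Lin A C r :=
  ⟨fun m n t => G.1 m n ⟨t.src + p, t.tgt, by have := t.eq; omega⟩ ∘ₗ
      F.1 m n ⟨t.src, t.src + p, rfl⟩, by
    intro m n a c hc σ τ x
    have e₁ := F.2 m n a (a + p) rfl σ τ x
    have e₂ := G.2 m n (a + p) c (by omega) σ τ (F.1 m n ⟨a, a + p, rfl⟩ x)
    simp only [LinearMap.comp_apply, e₁, e₂]⟩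

/-- `Ex(u)`, the extension of `u ∈ Lin_{Σ-Σ}(E, Q)` to a derivation: the inverse of the
restriction `Der(F(E), Q_β) → Lin_{Σ-Σ}(E, Q)`. -/
noncomputable def Ex {E : GrBimod.{u, v} k} {Q : GrPROP.{u, w} k} (β : PROPHom (freePROP E) Q)
    {d : ℤ} : Lin E Q.toBimod d → Der β d :=
  Function.invFun (restrictGen β d)

/-- `φ ↦ φ̃`, the extension of a derivation `P → P * Q` to a derivation of `P * Q` that vanishes
on `Q`: the inverse of the restriction to `P`. -/
noncomputable def tilde {P : GrPROP.{u, v} k} {Q : GrPROP.{u, w} k} {d : ℤ} :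
    Der (coprodInl P Q) d → DerVanish P Q d :=
  Function.invFun (restrictLeft P Q d)

/-- The degree `d` part of `Der(F(E), F(E) * Q)`. -/
abbrev DerFree (E : GrBimod.{u, v} k) (Q : GrPROP.{u, w} k) (d : ℤ) :
    Submodule k (GrMap k (freePROP E).obj (coprod (freePROP E) Q).obj d) :=
  Der (coprodInl (freePROP E) Q) d

/-- The product `θ ⋄ φ = (-1)^{|θ||φ|} Ex(φ̃ ∘ θ|_E)` on `Der(F(E), F(E) * Q)`. -/
noncomputable def diamond {E : GrBimod.{u, v} k} {Q : GrPROP.{u, w} k} {p q r : ℤ}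
    (h : p + q = r) (θ : DerFree E Q p) (φ : DerFree E Q q) : DerFree E Q r :=
  ksign k (p * q) • Ex (coprodInl (freePROP E) Q)
    (compLin h ⟨(tilde φ).1.1, (tilde φ).1.2.1⟩ (restrictGen (coprodInl (freePROP E) Q) p θ))

/-- The graph of the action of the morphisms `g : E → E'` and `f : Q → Q'` on derivations: `θ` and
`θ'` are intertwined if `(F(g) * f) ∘ θ = θ' ∘ F(g)`.  For an isomorphism `g` this says that
`θ' = (F(g) * f) ∘ θ ∘ F(g)⁻¹`. -/
def Intertwined {E : GrBimod.{u, v₁} k} {E' : GrBimod.{u, v₂} k} {Q : GrPROP.{u, v₃} k}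
    {Q' : GrPROP.{u, v₄} k} (g : GrBimodHom E E') (f : PROPHom Q Q') {d : ℤ}
    (θ : DerFree E Q d) (θ' : DerFree E' Q' d) : Prop :=
  ∀ (m n : ℕ) (a c : ℤ) (h : a + d = c) (x : (freePROP E).obj m n a),
    (coprodMap (freeMap g) f).map (θ.1 m n ⟨a, c, h⟩ x)
      = θ'.1 m n ⟨a, c, h⟩ ((freeMap g).map x)

end Der

/-! ### Graded pre-Lie algebras -/

/-- A graded pre-Lie algebra structure on a graded vector space `V = (V_d)_{d ∈ ℤ}`: a degree `0`
bilinear product whose associator `A(x, y, z) = (x ⋄ y) ⋄ z - x ⋄ (y ⋄ z)` is graded symmetric in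
`y` and `z`. -/
structure GrPreLie (k : Type u) [Field k] (V : ℤ → Type v) [∀ d, AddCommGroup (V d)]
    [∀ d, Module k (V d)] where
  mul : ∀ {p q r : ℤ}, p + q = r → (V p →ₗ[k] V q →ₗ[k] V r)
  assoc_symm : ∀ {p q s pq qs ps sq t : ℤ} (hpq : p + q = pq) (hqs : q + s = qs) (hps : p + s = ps)
    (hsq : s + q = sq) (h₁ : pq + s = t) (h₂ : p + qs = t) (h₃ : ps + q = t) (h₄ : p + sq = t)
    (x : V p) (y : V q) (z : V s),
    mul h₁ (mul hpq x y) z - mul h₂ x (mul hqs y z)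
      = ksign k (q * s) • (mul h₃ (mul hps x z) y - mul h₄ x (mul hsq z y))

end Markl

/-! A derivation is controlled by its values on generators. It kills all permutations, so two
derivations along the same homomorphism that agree on generators agree everywhere (`Der.eq_of_gen`).
Conversely, values prescribed on generators extend to formal expressions by the Leibniz rule, and
the extension descends to the quotient as soon as it respects the defining relations, because the
Leibniz rule is compatible with every PROP axiom (`Cong.der_eq`, `presDer`). For `F(E)` the
relations ask for linearity and bi-equivariance on `E`. For `M * Q` one prescribes `φ` on `M` and
`0` on `Q`, and the relations hold because `φ` is a derivation. This gives both bijections.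

For the pre-Lie identity write `ε` for the sign of `|φ||ψ|`. On a generator `x` with `y = θ(x)`, the
associator `A(θ, φ, ψ)` is a sign symmetric in `φ` and `ψ` times `ε ψ̃φ̃(y) - (φ ⋄ ψ)~(y)`. Hence
graded symmetry amounts to `φ̃ψ̃ - ε ψ̃φ̃ = ε (ψ ⋄ φ)~ - (φ ⋄ ψ)~`, which is `tilde_commutator`. A
composite such as `φ̃ψ̃` is not a derivation, but the graded commutator on the left is one
(`Der.commutator_mem`), so the identity need only be checked on `Q`, where all terms vanish, and on
the generators `E`, where it is the definition of `⋄`.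

Naturality rests on the same uniqueness: both sides of each square are derivations along one
homomorphism, and they are compared on generators. -/

namespace Markl

open Equiv (Perm)

/-! ### Koszul signs -/

section Sign

variable (k : Type u) [Field k]

theorem ksign_zero : ksign k 0 = 1 := by simp [ksign]

theorem ksign_add (a b : ℤ) : ksign k (a + b) = ksign k a * ksign k b := by
  simp [ksign, Int.negOnePow_add]

/-- The sign identities below hold only because one sign occurs squared. Splitting on its two values
turns each of them into a linear identity that `module` can check. -/
theorem ksign_eq_or (a : ℤ) : ksign k a = 1 ∨ ksign k a = -1 := by
  obtain h | h := Int.units_eq_one_or a.negOnePow <;> simp [ksign, h]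

end Sign

/-! ### Derivations of a PROP given by generators and relations -/

section Extension

variable {k : Type u} [Field k] {X : ℕ → ℕ → ℤ → Type v}

/-- The value on a formal expression of the derivation of degree `d` that sends the generators `x`
to `D x` and the permutations to `0`, along the evaluation given by `j`. -/
def Term.der (Q : GrPROP.{u, w} k) (j : ∀ {m n : ℕ} {d : ℤ}, X m n d → Q.obj m n d) (d : ℤ)
    (D : ∀ {m n : ℕ} {a c : ℤ}, a + d = c → X m n a → Q.obj m n c) :
    ∀ {m n : ℕ} {a : ℤ}, Term k X m n a → ∀ c : ℤ, a + d = c → Q.obj m n c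
  | _, _, _, .gen x => fun _ hc => D hc x
  | _, _, _, .perm _ => fun _ _ => 0
  | _, _, _, .vcomp (a := a) (b := b) h s t => fun c hc =>
      Q.vcomp (by omega) (s.der Q j d D (a + d) rfl) (t.eval Q j)
        + ksign k (d * a) • Q.vcomp (by omega) (s.eval Q j) (t.der Q j d D (b + d) rfl)
  | _, _, _, .hcomp (a := a) (b := b) hm hn h s t => fun c hc =>
      Q.hcomp hm hn (by omega) (s.der Q j d D (a + d) rfl) (t.eval Q j)
        + ksign k (d * a) • Q.hcomp hm hn (by omega) (s.eval Q j) (t.der Q j d D (b + d) rfl)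
  | _, _, _, .zero => fun _ _ => 0
  | _, _, _, .add s t => fun c hc => s.der Q j d D c hc + t.der Q j d D c hc
  | _, _, _, .smul r t => fun c hc => r • t.der Q j d D c hc

/-- The Leibniz extension is compatible with every axiom of a PROP, so only the relations `R` have
to be tested. The evaluation must respect `R` too (`hj`), since each Leibniz term contains the value
of the factor that is not differentiated. -/
theorem Cong.der_eq {R : ∀ (m n : ℕ) (d : ℤ), Term k X m n d → Term k X m n d → Prop}
    (Q : GrPROP.{u, w} k) (j : ∀ {m n : ℕ} {d : ℤ}, X m n d → Q.obj m n d)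
    (hj : ∀ {m n : ℕ} {d : ℤ} {s t : Term k X m n d}, R m n d s t → s.eval Q j = t.eval Q j)
    (d : ℤ) (D : ∀ {m n : ℕ} {a c : ℤ}, a + d = c → X m n a → Q.obj m n c)
    (hD : ∀ {m n : ℕ} {a : ℤ} {s t : Term k X m n a}, R m n a s t → ∀ (c : ℤ) (hc : a + d = c),
      s.der Q j d D c hc = t.der Q j d D c hc)
    {m n : ℕ} {a : ℤ} {s t : Term k X m n a} (h : Cong R s t) :
    ∀ (c : ℤ) (hc : a + d = c), s.der Q j d D c hc = t.der Q j d D c hc := by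
  induction h with
  | rel h => exact hD h
  | refl => intros; rfl
  | symm _ ih => intro c hc; exact (ih c hc).symm
  | trans _ _ ih ih' => intro c hc; exact (ih c hc).trans (ih' c hc)
  | vcomp_congr _ h h' ih ih' =>
    intro c hc; simp only [Term.der, ih, ih', h.eval_eq Q j hj, h'.eval_eq Q j hj]
  | hcomp_congr _ _ _ h h' ih ih' =>
    intro c hc; simp only [Term.der, ih, ih', h.eval_eq Q j hj, h'.eval_eq Q j hj]
  | add_congr _ _ ih ih' => intro c hc; simp only [Term.der, ih, ih']
  | smul_congr _ _ ih => intro c hc; simp only [Term.der, ih]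
  | add_assoc => intro c hc; exact _root_.add_assoc _ _ _
  | add_comm => intro c hc; exact _root_.add_comm _ _
  | zero_add => intro c hc; exact _root_.zero_add _
  | neg_add => intro c hc; simp [Term.der]
  | smul_add => intro c hc; exact _root_.smul_add _ _ _
  | add_smul => intro c hc; exact _root_.add_smul _ _ _
  | mul_smul => intro c hc; exact SemigroupAction.mul_smul _ _ _
  | one_smul => intro c hc; exact _root_.one_smul _ _
  | vcomp_add_left | vcomp_add_right | hcomp_add_left | hcomp_add_right
  | vcomp_smul_left | vcomp_smul_right | hcomp_smul_left | hcomp_smul_right =>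
    intro c hc
    simp only [Term.der, Term.eval, map_add, map_smul, LinearMap.add_apply, LinearMap.smul_apply]
    module
  | perm_mul => intro c hc; simp [Term.der]
  | one_vcomp f =>
    intro c hc
    obtain rfl := hc
    simp [Term.der, Term.eval, ksign_zero, Q.one_vcomp]
  | vcomp_one f =>
    intro c hc
    obtain rfl := hc
    simp [Term.der, Term.eval, Q.vcomp_one]
  | @vcomp_assoc m l p n a b c ab bc abc h₁ h₂ h₃ h₄ f g h =>
    intro e he
    subst h₁ h₃ h₂ he
    simp only [Term.der, Term.eval, map_add, map_smul, LinearMap.add_apply, LinearMap.smul_apply,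
      mul_add, ksign_add]
    -- One reassociation for each of the three factors the derivation can hit. The stated equations
    -- fix the degree of the inner composite to the form in which it occurs on the right-hand side.
    rw [Q.vcomp_assoc _ _ rfl (by omega),
      Q.vcomp_assoc _ _ (show b + d + c = b + c + d by ring) (by omega),
      Q.vcomp_assoc _ _ (show b + (c + d) = b + c + d by ring) (by omega)]
    module
  | @hcomp_assoc m₁ m₂ m₃ m₁₂ m₂₃ m n₁ n₂ n₃ n₁₂ n₂₃ n a b c ab bc abc i₁ i₂ i₃ i₄ j₁ j₂ j₃ j₄ h₁ h₂ h₃ h₄ f g h =>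
    intro e he
    subst h₁ h₃ h₂ he
    simp only [Term.der, Term.eval, map_add, map_smul, LinearMap.add_apply, LinearMap.smul_apply,
      mul_add, ksign_add]
    rw [Q.hcomp_assoc _ _ i₃ i₄ _ _ j₃ j₄ _ _ rfl (by omega),
      Q.hcomp_assoc _ _ i₃ i₄ _ _ j₃ j₄ _ _
        (show b + d + c = b + c + d by ring) (by omega),
      Q.hcomp_assoc _ _ i₃ i₄ _ _ j₃ j₄ _ _
        (show b + (c + d) = b + c + d by ring) (by omega)]
    module
  | unit_hcomp f =>
    intro c hc
    obtain rfl := hc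
    simp [Term.der, Term.eval, ksign_zero, Q.unit_hcomp]
  | hcomp_unit f =>
    intro c hc
    obtain rfl := hc
    simp [Term.der, Term.eval, Q.hcomp_unit]
  | perm_hcomp => intro c hc; simp [Term.der]
  | @interchange m m' M l l' L n n' N a b a' b' ab ab' aa bb c hM hL hN h₁ h₂ h₃ h₄ h₅ h₆ f g f' g' =>
    intro e he
    subst h₁ h₂ h₄ h₅ h₃ he
    simp only [Term.der, Term.eval, map_add, map_smul, LinearMap.add_apply, LinearMap.smul_apply]
    rw [Q.interchange _ _ hN _ _ _ (show a + d + a' = a + a' + d by ring) rfl (by omega),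
      Q.interchange _ _ hN _ _ _ rfl (show b + d + b' = b + b' + d by ring) (by omega),
      Q.interchange _ _ hN _ _ _ (show a + (a' + d) = a + a' + d by ring) rfl (by omega),
      Q.interchange _ _ hN _ _ _ rfl (show b + (b' + d) = b + b' + d by ring) (by omega)]
    simp only [mul_add, add_mul, ksign_add, mul_comm _ d]
    -- When the derivation hits `f'`, the sign of `d * b` appears twice: once from passing `g` in
    -- the Leibniz rule and once from the interchange law.
    obtain e | e := ksign_eq_or k (d * b) <;> rw [e] <;> module
  | @swap m m' n n' a b c h h' f g =>
    intro e he
    subst h he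
    simp only [Term.der, Term.eval, map_add, map_smul, LinearMap.add_apply, LinearMap.smul_apply,
      map_zero, LinearMap.zero_apply]
    rw [Q.swap _ (show b + (a + d) = a + b + d by omega),
      Q.swap _ (show b + d + a = a + b + d by omega)]
    simp only [mul_add, add_mul, mul_zero, ksign_zero, ksign_add, mul_comm _ d]
    -- When the derivation hits `g`, the sign of `d * a` appears both from the Leibniz rule and from
    -- swapping `f` with the derivative of `g`.
    obtain e | e := ksign_eq_or k (d * a) <;> rw [e] <;> module


variable {R : ∀ (m n : ℕ) (d : ℤ), Term k X m n d → Term k X m n d → Prop}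

/-- Every homomorphism out of a presented PROP is evaluation at its own values on generators, so
derivations along an arbitrary `β` can be built from `Term.der`. -/
theorem Term.eval_map_gen {Q : GrPROP.{u, w} k} (β : PROPHom (presented R) Q) {m n : ℕ} {d : ℤ}
    (t : Term k X m n d) :
    t.eval Q (fun x => β.map (PresObj.mk R (.gen x))) = β.map (PresObj.mk R t) := by
  induction t with
  | gen x => rfl
  | perm σ => exact (β.map_perm σ).symm
  | vcomp h s t ihs iht => simp only [Term.eval, ihs, iht]; exact (β.map_vcomp h _ _).symm
  | hcomp hm hn h s t ihs iht =>
    simp only [Term.eval, ihs, iht]; exact (β.map_hcomp hm hn h _ _).symm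
  | zero => exact (map_zero β.map).symm
  | add s t ihs iht => simp only [Term.eval, ihs, iht]; exact (map_add β.map _ _).symm
  | smul r t ih => simp only [Term.eval, ih]; exact (map_smul β.map r _).symm

/-- The bimodule action is composition with permutations. If these are sent to `0`, the Leibniz rule
for `σ ∘ x ∘ τ` keeps only the term differentiating `x`, with sign `(-1)^(d * 0) = 1`, so
bi-equivariance is automatic. -/
theorem IsLeibniz.mem_Der {P : GrPROP.{u, v} k} {Q : GrPROP.{u, w} k} {β : PROPHom P Q} {d : ℤ}
    {θ : GrMap k P.obj Q.obj d} (hθ : IsLeibniz β θ)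
    (hperm : ∀ {n : ℕ} (c : ℤ) (hc : 0 + d = c) (σ : Perm (Fin n)),
      θ n n ⟨0, c, hc⟩ (P.perm σ) = 0) : θ ∈ Der β d := by
  refine ⟨?_, hθ⟩
  intro m n a c hc σ τ x
  change θ m n ⟨a, c, hc⟩ (P.vcomp _ (P.vcomp _ (P.perm σ) x) (P.perm τ)) =
    Q.vcomp _ (Q.vcomp _ (Q.perm σ) (θ m n ⟨a, c, hc⟩ x)) (Q.perm τ)
  rw [hθ.1 (add_zero a) hc (zero_add d) hc (add_zero c) hc, hperm,
    hθ.1 (zero_add a) (zero_add d) hc hc (by omega) (zero_add c), hperm]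
  simp [ksign_zero, β.map_perm]

/-- From `1 = 1 ∘ 1` the Leibniz rule gives `θ(1) = θ(1) + θ(1)`, so `θ(1) = 0`; bi-equivariance
then carries this to every `σ = σ ∘ 1`. -/
theorem Der.map_perm {P : GrPROP.{u, v} k} {Q : GrPROP.{u, w} k} {β : PROPHom P Q} {d : ℤ}
    {θ : GrMap k P.obj Q.obj d} (hθ : θ ∈ Der β d) {n : ℕ} (c : ℤ) (hc : 0 + d = c)
    (σ : Perm (Fin n)) : θ n n ⟨0, c, hc⟩ (P.perm σ) = 0 := by
  have h₁ : θ n n ⟨0, c, hc⟩ (P.perm 1) = 0 := by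
    have h := hθ.2.1 (add_zero 0) hc hc hc (add_zero c) (zero_add c) (P.perm (1 : Perm (Fin n)))
      (P.perm 1)
    rw [P.one_vcomp, β.map_perm, Q.vcomp_one, Q.one_vcomp, mul_zero, ksign_zero, one_smul] at h
    simpa using h
  have h := hθ.1 n n 0 c hc σ 1 (P.perm 1)
  rw [h₁, map_zero] at h
  change θ n n ⟨0, c, hc⟩ (P.vcomp _ (P.vcomp _ (P.perm σ) (P.perm 1)) (P.perm 1)) = 0 at h
  rwa [P.vcomp_one, P.vcomp_one] at h

/-- The derivation of a presented PROP with given values on the generators. -/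
def presDer {Q : GrPROP.{u, w} k} (β : PROPHom (presented R) Q) (d : ℤ)
    (D : ∀ {m n : ℕ} {a c : ℤ}, a + d = c → X m n a → Q.obj m n c)
    (hD : ∀ {m n : ℕ} {a : ℤ} {s t : Term k X m n a}, R m n a s t → ∀ (c : ℤ) (hc : a + d = c),
      s.der Q (fun x => β.map (PresObj.mk R (.gen x))) d D c hc
        = t.der Q (fun x => β.map (PresObj.mk R (.gen x))) d D c hc) : Der β d :=
  ⟨fun m n t =>
    { toFun := Quotient.lift
        (fun s => s.der Q (fun x => β.map (PresObj.mk R (.gen x))) d D t.tgt t.eq)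
        -- Evaluation respects `R` because it factors through `β`, which is defined on the quotient.
        fun _ _ h => Cong.der_eq Q _ (fun {_ _ _} s s' hs => by
          rw [s.eval_map_gen β, s'.eval_map_gen β, PresObj.sound (.rel hs)]) d D hD h _ _
      map_add' := by rintro ⟨s⟩ ⟨s'⟩; rfl
      map_smul' := by rintro r ⟨s⟩; rfl },
    IsLeibniz.mem_Der
      ⟨by
        rintro m l n a b c a' b' c' h rfl rfl hc h₁ h₂ ⟨f⟩ ⟨g⟩
        have ef := f.eval_map_gen β
        have eg := g.eval_map_gen β
        change Term.der Q _ d D (.vcomp h f g) c' hc = Q.vcomp h₁ _ (β.map (PresObj.mk R g)) +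
          ksign k (d * a) • Q.vcomp h₂ (β.map (PresObj.mk R f)) _
        -- With `β` of a class rewritten as the evaluation of its representative, the Leibniz rule
        -- is the defining clause of `Term.der`.
        rw [← ef, ← eg]
        rfl, by
        rintro m m' M n n' N a b c a' b' c' hm hn h rfl rfl hc h₁ h₂ ⟨f⟩ ⟨g⟩
        have ef := f.eval_map_gen β
        have eg := g.eval_map_gen β
        change Term.der Q _ d D (.hcomp hm hn h f g) c' hc =
          Q.hcomp hm hn h₁ _ (β.map (PresObj.mk R g)) +
          ksign k (d * a) • Q.hcomp hm hn h₂ (β.map (PresObj.mk R f)) _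
        rw [← ef, ← eg]
        rfl⟩
      fun _ _ _ => rfl⟩

/-- Induction on a formal expression representing the element: permutations go to `0` under both
derivations, and the two compositions are governed by Leibniz rules along the same `β`. -/
theorem Der.eq_of_gen {Q : GrPROP.{u, w} k} {β : PROPHom (presented R) Q} {d : ℤ}
    {θ η : GrMap k (presented R).obj Q.obj d} (hθ : θ ∈ Der β d) (hη : η ∈ Der β d)
    (h : ∀ {m n : ℕ} {a : ℤ} (c : ℤ) (hc : a + d = c) (x : X m n a),
      θ m n ⟨a, c, hc⟩ (PresObj.mk R (.gen x)) = η m n ⟨a, c, hc⟩ (PresObj.mk R (.gen x))) :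
    θ = η := by
  have key : ∀ {m n : ℕ} {a : ℤ} (s : Term k X m n a) (c : ℤ) (hc : a + d = c),
      θ m n ⟨a, c, hc⟩ (PresObj.mk R s) = η m n ⟨a, c, hc⟩ (PresObj.mk R s) := by
    intro m n a s
    induction s with
    | gen x => exact fun c hc => h c hc x
    | perm σ => exact fun c hc => (map_perm hθ c hc σ).trans (map_perm hη c hc σ).symm
    | vcomp e s t ihs iht =>
      intro c hc
      have e₁ := hθ.2.1 e rfl rfl hc (by omega) (by omega) (PresObj.mk R s) (PresObj.mk R t)
      have e₂ := hη.2.1 e rfl rfl hc (by omega) (by omega) (PresObj.mk R s) (PresObj.mk R t)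
      rw [ihs, iht] at e₁
      exact e₁.trans e₂.symm
    | hcomp hm hn e s t ihs iht =>
      intro c hc
      have e₁ := hθ.2.2 hm hn e rfl rfl hc (by omega) (by omega) (PresObj.mk R s) (PresObj.mk R t)
      have e₂ := hη.2.2 hm hn e rfl rfl hc (by omega) (by omega) (PresObj.mk R s) (PresObj.mk R t)
      rw [ihs, iht] at e₁
      exact e₁.trans e₂.symm
    | zero => exact fun c hc => (map_zero (θ _ _ _)).trans (map_zero (η _ _ _)).symm
    | add s t ihs iht =>
      exact fun c hc => (map_add (θ _ _ _) _ _).trans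
        ((congrArg₂ (· + ·) (ihs c hc) (iht c hc)).trans (map_add (η _ _ _) _ _).symm)
    | smul r t ih =>
      exact fun c hc => (map_smul (θ _ _ _) r _).trans
        ((congrArg (r • ·) (ih c hc)).trans (map_smul (η _ _ _) r _).symm)
  funext m n t
  ext x
  obtain ⟨s⟩ := x
  exact key s t.tgt t.eq

end Extension

/-! ### The two restriction isomorphisms and their inverses -/

section Bijectivity

variable {k : Type u} [Field k]

theorem Der.eq_of_freeIncl {E : GrBimod.{u, v} k} {Q : GrPROP.{u, w} k}
    {β : PROPHom (freePROP E) Q} {d : ℤ} {θ η : GrMap k (freePROP E).obj Q.obj d}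
    (hθ : θ ∈ Der β d) (hη : η ∈ Der β d)
    (h : ∀ {m n : ℕ} {a : ℤ} (c : ℤ) (hc : a + d = c) (x : E.obj m n a),
      θ m n ⟨a, c, hc⟩ ((freeIncl E).map x) = η m n ⟨a, c, hc⟩ ((freeIncl E).map x)) :
    θ = η :=
  Der.eq_of_gen hθ hη h

theorem Der.eq_of_coprod {P : GrPROP.{u, v₁} k} {Q : GrPROP.{u, v₂} k} {S : GrPROP.{u, v₃} k}
    {β : PROPHom (coprod P Q) S} {d : ℤ} {θ η : GrMap k (coprod P Q).obj S.obj d}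
    (hθ : θ ∈ Der β d) (hη : η ∈ Der β d)
    (hl : ∀ {m n : ℕ} {a : ℤ} (c : ℤ) (hc : a + d = c) (x : P.obj m n a),
      θ m n ⟨a, c, hc⟩ ((coprodInl P Q).map x) = η m n ⟨a, c, hc⟩ ((coprodInl P Q).map x))
    (hr : ∀ {m n : ℕ} {a : ℤ} (c : ℤ) (hc : a + d = c) (x : Q.obj m n a),
      θ m n ⟨a, c, hc⟩ ((coprodInr P Q).map x) = η m n ⟨a, c, hc⟩ ((coprodInr P Q).map x)) :
    θ = η :=
  Der.eq_of_gen hθ hη (by rintro m n a c hc (x | x); exacts [hl c hc x, hr c hc x])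

theorem restrictGen_bijective {E : GrBimod.{u, v} k} {Q : GrPROP.{u, w} k}
    (β : PROPHom (freePROP E) Q) (d : ℤ) : Function.Bijective (restrictGen β d) := by
  constructor
  · intro θ η h
    refine Subtype.ext (Der.eq_of_freeIncl θ.2 η.2 fun {m n a} c hc x => ?_)
    exact congrArg (fun F : Lin E Q.toBimod d => F.1 m n ⟨a, c, hc⟩ x) h
  · intro F
    refine ⟨presDer β d (fun {m n a c} hc x => F.1 m n ⟨a, c, hc⟩ x) ?_, rfl⟩
    intro m n a s t h c hc
    cases h with
    | add x y => exact map_add (F.1 m n ⟨a, c, hc⟩) x y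
    | smul r x => exact map_smul (F.1 m n ⟨a, c, hc⟩) r x
    -- Differentiating `σ ∘ x ∘ τ` leaves only `σ ∘ F(x) ∘ τ`, so this relation is exactly the
    -- bi-equivariance of `F`.
    | act σ τ x =>
      refine (F.2 m n a c hc σ τ x).trans ?_
      subst hc
      simp [Term.der, Term.eval, ksign_zero]

theorem restrictLeft_bijective (P : GrPROP.{u, v} k) (Q : GrPROP.{u, w} k) (d : ℤ) :
    Function.Bijective (restrictLeft P Q d) := by
  constructor
  · intro θ η h
    refine Subtype.ext (Subtype.ext (Der.eq_of_coprod θ.1.2 η.1.2 (fun {m n a} c hc x => ?_)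
      fun {m n a} c hc x => ?_))
    · exact congrArg (fun F : Der (coprodInl P Q) d => F.1 m n ⟨a, c, hc⟩ x) h
    · rw [θ.2 m n a c hc x, η.2 m n a c hc x]
  · intro φ
    -- The generators of the coproduct are the elements of `P` and of `Q`; the extension takes the
    -- values of `φ` on the former and `0` on the latter.
    refine ⟨⟨presDer (PROPHom.id (coprod P Q)) d
      (fun {m n a c} hc x => Sum.elim (fun y => φ.1 m n ⟨a, c, hc⟩ y) (fun _ => 0) x) ?_, ?_⟩, rfl⟩
    · rintro m n a s t (h | h) c hc
      · cases h with
        | add x y => exact map_add (φ.1 m n ⟨a, c, hc⟩) x y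
        | smul r x => exact map_smul (φ.1 m n ⟨a, c, hc⟩) r x
        -- A permutation of `P` is a generator with value given by `φ`, but is identified with a
        -- formal permutation, whose value is `0`.
        | perm σ => exact Der.map_perm φ.2 c hc σ
        | vcomp e x y => exact φ.2.2.1 e rfl rfl hc (by omega) (by omega) x y
        | hcomp hm hn e x y => exact φ.2.2.2 hm hn e rfl rfl hc (by omega) (by omega) x y
      · cases h <;> simp [Term.der, Term.eval]
    · exact fun _ _ _ _ _ _ => rfl

/-- `Ex` is defined by choice; surjectivity of the restriction is what makes it a right inverse. -/
theorem restrictGen_Ex {E : GrBimod.{u, v} k} {Q : GrPROP.{u, w} k} (β : PROPHom (freePROP E) Q)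
    {d : ℤ} (F : Lin E Q.toBimod d) : restrictGen β d (Ex β F) = F :=
  Function.rightInverse_invFun (restrictGen_bijective β d).2 F

theorem restrictLeft_tilde {P : GrPROP.{u, v} k} {Q : GrPROP.{u, w} k} {d : ℤ}
    (φ : Der (coprodInl P Q) d) : restrictLeft P Q d (tilde φ) = φ :=
  Function.rightInverse_invFun (restrictLeft_bijective P Q d).2 φ

theorem tilde_coprodInl {P : GrPROP.{u, v} k} {Q : GrPROP.{u, w} k} {d : ℤ}
    (φ : Der (coprodInl P Q) d) {m n : ℕ} (t : DegPair d) (x : P.obj m n t.src) :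
    (tilde φ).1.1 m n t ((coprodInl P Q).map x) = φ.1 m n t x :=
  congrArg (fun F : Der (coprodInl P Q) d => F.1 m n t x) (restrictLeft_tilde φ)

theorem tilde_coprodInr {P : GrPROP.{u, v} k} {Q : GrPROP.{u, w} k} {d : ℤ}
    (φ : Der (coprodInl P Q) d) {m n : ℕ} (t : DegPair d) (x : Q.obj m n t.src) :
    (tilde φ).1.1 m n t ((coprodInr P Q).map x) = 0 :=
  (tilde φ).2 m n t.src t.tgt t.eq x

/-- Linearity of the chosen inverse is inherited from the restriction map through injectivity. -/
theorem tilde_add {P : GrPROP.{u, v} k} {Q : GrPROP.{u, w} k} {d : ℤ}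
    (φ ψ : Der (coprodInl P Q) d) : tilde (φ + ψ) = tilde φ + tilde ψ :=
  (restrictLeft_bijective P Q d).1 (by simp only [map_add, restrictLeft_tilde])

theorem tilde_smul {P : GrPROP.{u, v} k} {Q : GrPROP.{u, w} k} {d : ℤ} (r : k)
    (φ : Der (coprodInl P Q) d) : tilde (r • φ) = r • tilde φ :=
  (restrictLeft_bijective P Q d).1 (by simp only [map_smul, restrictLeft_tilde])

end Bijectivity

/-! ### The product `⋄` and the graded commutator -/

section Diamond

variable {k : Type u} [Field k]

/-- The working formula for `⋄`: with uniqueness on generators it replaces every appeal to `Ex`. The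
intermediate degree `b` is a free variable, so the formula applies however that degree is written.
-/
theorem diamond_freeIncl {E : GrBimod.{u, v} k} {Q : GrPROP.{u, w} k} {p q r : ℤ}
    (h : p + q = r) (θ : DerFree E Q p) (φ : DerFree E Q q) {m n : ℕ} {a b c : ℤ}
    (hb : a + p = b) (hq : b + q = c) (hc : a + r = c) (x : E.obj m n a) :
    (diamond h θ φ).1 m n ⟨a, c, hc⟩ ((freeIncl E).map x) =
      ksign k (p * q) • (tilde φ).1.1 m n ⟨b, c, hq⟩
        (θ.1 m n ⟨a, b, hb⟩ ((freeIncl E).map x)) := by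
  subst hb
  exact congrArg (fun F : Lin E (coprod (freePROP E) Q).toBimod r =>
    ksign k (p * q) • F.1 m n ⟨a, c, hc⟩ x) (restrictGen_Ex (coprodInl (freePROP E) Q)
      (compLin h ⟨(tilde φ).1.1, (tilde φ).1.2.1⟩ (restrictGen (coprodInl (freePROP E) Q) p θ)))

/-- The product `⋄` as a bilinear map. -/
noncomputable def diamondHom (E : GrBimod.{u, v} k) (Q : GrPROP.{u, w} k) {p q r : ℤ}
    (h : p + q = r) : DerFree E Q p →ₗ[k] DerFree E Q q →ₗ[k] DerFree E Q r :=
  LinearMap.mk₂ k (diamond h)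
    -- All four linearity conditions are equalities of derivations and are tested on generators;
    -- those in `φ` also use linearity of `tilde`.
    (fun θ θ' φ => Subtype.ext (Der.eq_of_freeIncl (diamond h (θ + θ') φ).2
      (diamond h θ φ + diamond h θ' φ).2 fun {m n a} c hc x => by
        have hq : a + p + q = c := by omega
        change _ = (diamond h θ φ).1 m n _ _ + (diamond h θ' φ).1 m n _ _
        simp only [diamond_freeIncl h _ _ rfl hq]
        rw [← smul_add, ← map_add]
        rfl))
    (fun r' θ φ => Subtype.ext (Der.eq_of_freeIncl (diamond h (r' • θ) φ).2
      (r' • diamond h θ φ).2 fun {m n a} c hc x => by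
        have hq : a + p + q = c := by omega
        change _ = r' • (diamond h θ φ).1 m n _ _
        simp only [diamond_freeIncl h _ _ rfl hq]
        rw [smul_comm r']
        exact congrArg (ksign k (p * q) • ·) (map_smul ((tilde φ).1.1 m n ⟨a + p, c, hq⟩) r' _)))
    (fun θ φ φ' => Subtype.ext (Der.eq_of_freeIncl (diamond h θ (φ + φ')).2
      (diamond h θ φ + diamond h θ φ').2 fun {m n a} c hc x => by
        have hq : a + p + q = c := by omega
        change _ = (diamond h θ φ).1 m n _ _ + (diamond h θ φ').1 m n _ _
        simp only [diamond_freeIncl h _ _ rfl hq, tilde_add]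
        rw [← smul_add]
        rfl))
    (fun r' θ φ => Subtype.ext (Der.eq_of_freeIncl (diamond h θ (r' • φ)).2
      (r' • diamond h θ φ).2 fun {m n a} c hc x => by
        have hq : a + p + q = c := by omega
        change _ = r' • (diamond h θ φ).1 m n _ _
        simp only [diamond_freeIncl h _ _ rfl hq, tilde_smul]
        rw [smul_comm]
        rfl))

/-- The composite of two families of linear maps of degrees `s` and `q`. -/
def GrMap.comp {A : GrPROP.{u, v} k} {q s r : ℤ} (h : q + s = r) (φ : GrMap k A.obj A.obj q)
    (ψ : GrMap k A.obj A.obj s) : GrMap k A.obj A.obj r :=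
  fun m n t => φ m n ⟨t.src + s, t.tgt, by have := t.eq; omega⟩ ∘ₗ ψ m n ⟨t.src, t.src + s, rfl⟩

theorem PROPHom.id_map (P : GrPROP.{u, v} k) {m n : ℕ} {d : ℤ} (x : P.obj m n d) :
    (PROPHom.id P).map x = x := rfl

/-- The graded commutator of two derivations is a derivation. -/
theorem Der.commutator_mem {P : GrPROP.{u, v} k} {q s r : ℤ} (h : q + s = r) (h' : s + q = r)
    {φ : GrMap k P.obj P.obj q} {ψ : GrMap k P.obj P.obj s}
    (hφ : φ ∈ Der (PROPHom.id P) q) (hψ : ψ ∈ Der (PROPHom.id P) s) :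
    φ.comp h ψ - ksign k (q * s) • ψ.comp h' φ ∈ Der (PROPHom.id P) r := by
  refine IsLeibniz.mem_Der ⟨?_, ?_⟩ ?_
  · intro m l n a b c a' b' c' h₀ ha hb hc h₁ h₂ f g
    subst ha hb hc h
    have hφψ {m n : ℕ} {a c : ℤ} (hc : a + (q + s) = c) (x : P.obj m n a) :
        (φ.comp rfl ψ - ksign k (q * s) • ψ.comp h' φ) m n ⟨a, c, hc⟩ x =
          φ m n ⟨a + s, c, by omega⟩ (ψ m n ⟨a, a + s, rfl⟩ x) -
            ksign k (q * s) • ψ m n ⟨a + q, c, by omega⟩ (φ m n ⟨a, a + q, rfl⟩ x) := rfl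
    simp only [hφψ, PROPHom.id_map]
    rw [hψ.2.1 h₀ rfl rfl rfl (by omega) (by omega),
      hφ.2.1 h₀ rfl rfl rfl (by omega) (by omega), map_add, map_add, map_smul, map_smul,
      hφ.2.1 (show a + s + b = c + s by omega) (show a + s + q = a + (q + s) by ring) rfl _ h₁
        (by omega),
      hφ.2.1 (show a + (b + s) = c + s by omega) rfl (show b + s + q = b + (q + s) by ring) _
        (by omega) h₂,
      hψ.2.1 (show a + q + b = c + q by omega) (show a + q + s = a + (q + s) by ring) rfl _ h₁
        (by omega),
      hψ.2.1 (show a + (b + q) = c + q by omega) rfl (show b + q + s = b + (q + s) by ring) _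
        (by omega) h₂]
    simp only [PROPHom.id_map, map_sub, map_smul, LinearMap.sub_apply, LinearMap.smul_apply,
      mul_add, add_mul, ksign_add, mul_comm s q]
    -- The mixed terms, where `φ` and `ψ` hit different factors, cancel between the two composites;
    -- this is what the sign in the commutator is for.
    obtain e | e := ksign_eq_or k (q * s) <;> rw [e] <;> module
  · intro m m' M n n' N a b c a' b' c' hm hn h₀ ha hb hc h₁ h₂ f g
    subst ha hb hc h
    have hφψ {m n : ℕ} {a c : ℤ} (hc : a + (q + s) = c) (x : P.obj m n a) :
        (φ.comp rfl ψ - ksign k (q * s) • ψ.comp h' φ) m n ⟨a, c, hc⟩ x =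
          φ m n ⟨a + s, c, by omega⟩ (ψ m n ⟨a, a + s, rfl⟩ x) -
            ksign k (q * s) • ψ m n ⟨a + q, c, by omega⟩ (φ m n ⟨a, a + q, rfl⟩ x) := rfl
    simp only [hφψ, PROPHom.id_map]
    rw [hψ.2.2 hm hn h₀ rfl rfl rfl (by omega) (by omega),
      hφ.2.2 hm hn h₀ rfl rfl rfl (by omega) (by omega), map_add, map_add, map_smul, map_smul,
      hφ.2.2 hm hn (show a + s + b = c + s by omega) (show a + s + q = a + (q + s) by ring) rfl _ h₁
        (by omega),
      hφ.2.2 hm hn (show a + (b + s) = c + s by omega) rfl (show b + s + q = b + (q + s) by ring) _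
        (by omega) h₂,
      hψ.2.2 hm hn (show a + q + b = c + q by omega) (show a + q + s = a + (q + s) by ring) rfl _ h₁
        (by omega),
      hψ.2.2 hm hn (show a + (b + q) = c + q by omega) rfl (show b + q + s = b + (q + s) by ring) _
        (by omega) h₂]
    simp only [PROPHom.id_map, map_sub, map_smul, LinearMap.sub_apply, LinearMap.smul_apply,
      mul_add, add_mul, ksign_add, mul_comm s q]
    obtain e | e := ksign_eq_or k (q * s) <;> rw [e] <;> module
  · intro n c hc σ
    change φ n n ⟨0 + s, c, by omega⟩ (ψ n n ⟨0, 0 + s, rfl⟩ (P.perm σ)) -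
      ksign k (q * s) • ψ n n ⟨0 + q, c, by omega⟩ (φ n n ⟨0, 0 + q, rfl⟩ (P.perm σ)) = 0
    rw [map_perm hφ, map_perm hψ]
    simp

end Diamond

/-! ### Naturality in the generators and in the PROP -/

section Naturality

variable {k : Type u} [Field k]

/-- Together with `Der.precomp_mem`, this presents both ways around a square as derivations, ready
for comparison on generators. -/
theorem Der.postcomp_mem {P : GrPROP.{u, v₁} k} {Q : GrPROP.{u, v₂} k} {S : GrPROP.{u, v₃} k}
    {β : PROPHom P Q} (α : PROPHom Q S) {d : ℤ} {θ : GrMap k P.obj Q.obj d} (hθ : θ ∈ Der β d) :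
    (fun m n t => α.map ∘ₗ θ m n t : GrMap k P.obj S.obj d) ∈ Der (α.comp β) d := by
  refine IsLeibniz.mem_Der ⟨?_, ?_⟩ ?_
  · intro m l n a b c a' b' c' h ha hb hc h₁ h₂ f g
    simp only [LinearMap.comp_apply, hθ.2.1 h ha hb hc h₁ h₂, map_add, map_smul, α.map_vcomp]
    rfl
  · intro m m' M n n' N a b c a' b' c' hm hn h ha hb hc h₁ h₂ f g
    simp only [LinearMap.comp_apply, hθ.2.2 hm hn h ha hb hc h₁ h₂, map_add, map_smul, α.map_hcomp]
    rfl
  · intro n c hc σ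
    simp only [LinearMap.comp_apply, map_perm hθ, map_zero]

theorem Der.precomp_mem {P : GrPROP.{u, v₁} k} {Q : GrPROP.{u, v₂} k} {S : GrPROP.{u, v₃} k}
    {β : PROPHom Q S} (α : PROPHom P Q) {d : ℤ} {θ : GrMap k Q.obj S.obj d} (hθ : θ ∈ Der β d) :
    (fun m n t => θ m n t ∘ₗ α.map : GrMap k P.obj S.obj d) ∈ Der (β.comp α) d := by
  refine IsLeibniz.mem_Der ⟨?_, ?_⟩ ?_
  · intro m l n a b c a' b' c' h ha hb hc h₁ h₂ f g
    simp only [LinearMap.comp_apply, hθ.2.1 h ha hb hc h₁ h₂, α.map_vcomp]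
    rfl
  · intro m m' M n n' N a b c a' b' c' hm hn h ha hb hc h₁ h₂ f g
    simp only [LinearMap.comp_apply, hθ.2.2 hm hn h ha hb hc h₁ h₂, α.map_hcomp]
    rfl
  · intro n c hc σ
    simp only [LinearMap.comp_apply, α.map_perm, map_perm hθ]

theorem PROPHom.ext {P : GrPROP.{u, v} k} {Q : GrPROP.{u, w} k} {α β : PROPHom P Q}
    (h : ∀ {m n : ℕ} {d : ℤ} (x : P.obj m n d), α.map x = β.map x) : α = β := by
  obtain ⟨α, _, _, _⟩ := α
  obtain ⟨β, _, _, _⟩ := β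
  have : @α = @β := by
    funext m n d
    exact LinearMap.ext h
  subst this
  rfl

theorem coprodMap_inl {P : GrPROP.{u, v₁} k} {Q : GrPROP.{u, v₂} k} {P' : GrPROP.{u, v₃} k}
    {Q' : GrPROP.{u, v₄} k} (α : PROPHom P P') (β : PROPHom Q Q') {m n : ℕ} {d : ℤ}
    (x : P.obj m n d) :
    (coprodMap α β).map ((coprodInl P Q).map x) = (coprodInl P' Q').map (α.map x) := rfl

theorem coprodMap_inr {P : GrPROP.{u, v₁} k} {Q : GrPROP.{u, v₂} k} {P' : GrPROP.{u, v₃} k}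
    {Q' : GrPROP.{u, v₄} k} (α : PROPHom P P') (β : PROPHom Q Q') {m n : ℕ} {d : ℤ}
    (x : Q.obj m n d) :
    (coprodMap α β).map ((coprodInr P Q).map x) = (coprodInr P' Q').map (β.map x) := rfl

theorem freeMap_freeIncl {E : GrBimod.{u, v} k} {E' : GrBimod.{u, w} k} (g : GrBimodHom E E')
    {m n : ℕ} {d : ℤ} (x : E.obj m n d) :
    (freeMap g).map ((freeIncl E).map x) = (freeIncl E').map (g.map x) := rfl

variable {E : GrBimod.{u, v₁} k} {E' : GrBimod.{u, v₂} k} {Q : GrPROP.{u, v₃} k}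
  {Q' : GrPROP.{u, v₄} k} {g : GrBimodHom E E'} {f : PROPHom Q Q'}

/-- If `φ` and `φ'` are intertwined, then so are their extensions to the coproducts. -/
theorem Intertwined.tilde {q : ℤ} {φ : DerFree E Q q} {φ' : DerFree E' Q' q}
    (h : Intertwined g f φ φ') {m n : ℕ} {a c : ℤ} (hc : a + q = c)
    (x : (coprod (freePROP E) Q).obj m n a) :
    (coprodMap (freeMap g) f).map ((tilde φ).1.1 m n ⟨a, c, hc⟩ x) =
      (tilde φ').1.1 m n ⟨a, c, hc⟩ ((coprodMap (freeMap g) f).map x) := by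
  have h₁ := Der.postcomp_mem (coprodMap (freeMap g) f) (Markl.tilde φ).1.2
  have h₂ := Der.precomp_mem (coprodMap (freeMap g) f) (Markl.tilde φ').1.2
  -- Uniqueness needs both derivations to lie over the same homomorphism, here `F(g) * f`.
  have e : (coprodMap (freeMap g) f).comp (PROPHom.id _) =
    (PROPHom.id _).comp (coprodMap (freeMap g) f) := PROPHom.ext fun _ => rfl
  rw [e] at h₁
  have key := Der.eq_of_coprod h₁ h₂
    (by
      intro m n a c hc x
      rw [LinearMap.comp_apply, LinearMap.comp_apply, coprodMap_inl, tilde_coprodInl φ ⟨a, c, hc⟩,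
        tilde_coprodInl φ' ⟨a, c, hc⟩]
      exact h m n a c hc x)
    (by
      intro m n a c hc x
      rw [LinearMap.comp_apply, LinearMap.comp_apply, coprodMap_inr, tilde_coprodInr φ ⟨a, c, hc⟩,
        tilde_coprodInr φ' ⟨a, c, hc⟩, map_zero])
  exact LinearMap.congr_fun (congrFun (congrFun (congrFun key m) n) ⟨a, c, hc⟩) x

/-- Both sides are derivations along `(F(g) * f) ∘ i_M = i_M' ∘ F(g)`. On a generator `x`, up to the
common sign, `F(g) * f` moves past `φ̃` by `Intertwined.tilde` and past `θ` by hypothesis; the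
result is again the formula for `⋄` because `F(g)` sends generators to generators. -/
theorem Intertwined.diamond {p q r : ℤ} (h : p + q = r) {θ : DerFree E Q p} {φ : DerFree E Q q}
    {θ' : DerFree E' Q' p} {φ' : DerFree E' Q' q} (hθ : Intertwined g f θ θ')
    (hφ : Intertwined g f φ φ') : Intertwined g f (diamond h θ φ) (diamond h θ' φ') := by
  intro m n a c hc x
  have h₁ := Der.postcomp_mem (coprodMap (freeMap g) f) (Markl.diamond h θ φ).2
  have h₂ := Der.precomp_mem (freeMap g) (Markl.diamond h θ' φ').2
  have e : (coprodMap (freeMap g) f).comp (coprodInl _ _) =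
    (coprodInl _ _).comp (freeMap g) := PROPHom.ext fun _ => rfl
  rw [e] at h₁
  have key := Der.eq_of_freeIncl h₁ h₂
    (by
      intro m n a c hc x
      have hq : a + p + q = c := by omega
      rw [LinearMap.comp_apply, LinearMap.comp_apply, freeMap_freeIncl,
        diamond_freeIncl h θ φ rfl hq hc, diamond_freeIncl h θ' φ' rfl hq hc, map_smul,
        hφ.tilde hq, hθ m n a _ rfl, freeMap_freeIncl])
  exact LinearMap.congr_fun (congrFun (congrFun (congrFun key m) n) ⟨a, c, hc⟩) x

end Naturality

/-! ### The pre-Lie identity -/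

section PreLie

variable {k : Type u} [Field k] {E : GrBimod.{u, v} k} {Q : GrPROP.{u, w} k}

/-- Extension to the coproduct carries the commutator of the product `⋄` to the commutator of
derivations. -/
theorem tilde_commutator {q s r : ℤ} (h : q + s = r) (h' : s + q = r) (φ : DerFree E Q q)
    (ψ : DerFree E Q s) {m n : ℕ} {a b b' c : ℤ} (hc : a + r = c) (hb : a + s = b) (hq : b + q = c)
    (hb' : a + q = b') (hs : b' + s = c) (x : (coprod (freePROP E) Q).obj m n a) :
    (tilde φ).1.1 m n ⟨b, c, hq⟩ ((tilde ψ).1.1 m n ⟨a, b, hb⟩ x) -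
        ksign k (q * s) • (tilde ψ).1.1 m n ⟨b', c, hs⟩ ((tilde φ).1.1 m n ⟨a, b', hb'⟩ x) =
      ksign k (q * s) • (tilde (diamond h' ψ φ)).1.1 m n ⟨a, c, hc⟩ x -
        (tilde (diamond h φ ψ)).1.1 m n ⟨a, c, hc⟩ x := by
  subst hb hb'
  have h₁ := Der.commutator_mem h h' (tilde φ).1.2 (tilde ψ).1.2
  have h₂ := sub_mem (Submodule.smul_mem _ (ksign k (q * s)) (tilde (diamond h' ψ φ)).1.2)
    (tilde (diamond h φ ψ)).1.2
  -- Restricted to `M`, both sides are derivations along the inclusion, so generators in `E`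
  -- suffice.
  have hM := Der.eq_of_freeIncl (Der.precomp_mem (coprodInl _ _) h₁)
    (Der.precomp_mem (coprodInl _ _) h₂) (by
      intro m n a c hc x
      have hq : a + s + q = c := by omega
      have hs : a + q + s = c := by omega
      change (tilde φ).1.1 m n ⟨a + s, c, hq⟩ ((tilde ψ).1.1 m n ⟨a, a + s, rfl⟩
          ((coprodInl (freePROP E) Q).map ((freeIncl E).map x))) -
        ksign k (q * s) • (tilde ψ).1.1 m n ⟨a + q, c, hs⟩ ((tilde φ).1.1 m n ⟨a, a + q, rfl⟩
          ((coprodInl (freePROP E) Q).map ((freeIncl E).map x))) =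
        ksign k (q * s) • (tilde (diamond h' ψ φ)).1.1 m n ⟨a, c, hc⟩
          ((coprodInl (freePROP E) Q).map ((freeIncl E).map x)) -
        (tilde (diamond h φ ψ)).1.1 m n ⟨a, c, hc⟩
          ((coprodInl (freePROP E) Q).map ((freeIncl E).map x))
      rw [tilde_coprodInl ψ ⟨a, a + s, rfl⟩, tilde_coprodInl φ ⟨a, a + q, rfl⟩,
        tilde_coprodInl _ ⟨a, c, hc⟩, tilde_coprodInl _ ⟨a, c, hc⟩,
        diamond_freeIncl h' ψ φ rfl hq hc, diamond_freeIncl h φ ψ rfl hs hc, mul_comm s q]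
      -- The sign in the definition of `ψ ⋄ φ` cancels the one in front of it.
      obtain e | e := ksign_eq_or k (q * s) <;> rw [e] <;> module)
  have key := Der.eq_of_coprod h₁ h₂
    (fun {m n a} c hc x => LinearMap.congr_fun (congrFun (congrFun (congrFun hM m) n) ⟨a, c, hc⟩) x)
    (by
      intro m n a c hc x
      have hq : a + s + q = c := by omega
      have hs : a + q + s = c := by omega
      change (tilde φ).1.1 m n ⟨a + s, c, hq⟩ ((tilde ψ).1.1 m n ⟨a, a + s, rfl⟩
          ((coprodInr (freePROP E) Q).map x)) -
        ksign k (q * s) • (tilde ψ).1.1 m n ⟨a + q, c, hs⟩ ((tilde φ).1.1 m n ⟨a, a + q, rfl⟩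
          ((coprodInr (freePROP E) Q).map x)) =
        ksign k (q * s) • (tilde (diamond h' ψ φ)).1.1 m n ⟨a, c, hc⟩
          ((coprodInr (freePROP E) Q).map x) -
        (tilde (diamond h φ ψ)).1.1 m n ⟨a, c, hc⟩ ((coprodInr (freePROP E) Q).map x)
      rw [tilde_coprodInr ψ ⟨a, a + s, rfl⟩, tilde_coprodInr φ ⟨a, a + q, rfl⟩,
        tilde_coprodInr _ ⟨a, c, hc⟩, tilde_coprodInr _ ⟨a, c, hc⟩, map_zero, map_zero,
        smul_zero])
  exact LinearMap.congr_fun (congrFun (congrFun (congrFun key m) n) ⟨a, c, hc⟩) x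

/-- On a generator, all four products become operators applied to the single element `θ(x)`, and the
claim is `tilde_commutator` evaluated there, up to a sign common to both associators. -/
theorem diamond_assoc_symm {p q s pq qs ps sq t : ℤ} (hpq : p + q = pq) (hqs : q + s = qs)
    (hps : p + s = ps) (hsq : s + q = sq) (h₁ : pq + s = t) (h₂ : p + qs = t) (h₃ : ps + q = t)
    (h₄ : p + sq = t) (θ : DerFree E Q p) (φ : DerFree E Q q) (ψ : DerFree E Q s) :
    diamond h₁ (diamond hpq θ φ) ψ - diamond h₂ θ (diamond hqs φ ψ) =
      ksign k (q * s) • (diamond h₃ (diamond hps θ ψ) φ - diamond h₄ θ (diamond hsq ψ φ)) := by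
  refine Subtype.ext (Der.eq_of_freeIncl (Subtype.prop _) (Subtype.prop _) ?_)
  intro m n a c hc x
  -- Puts `φ ⋄ ψ` and `ψ ⋄ φ` in literally the same degree, as the commutator identity requires.
  obtain rfl : qs = sq := by omega
  have i₁ : a + p + q + s = c := by omega
  have i₂ : a + p + qs = c := by omega
  have i₃ : a + p + s + q = c := by omega
  have i₄ : a + pq = a + p + q := by omega
  have i₅ : a + ps = a + p + s := by omega
  change (diamond h₁ (diamond hpq θ φ) ψ).1 m n ⟨a, c, hc⟩ ((freeIncl E).map x) -
      (diamond h₂ θ (diamond hqs φ ψ)).1 m n ⟨a, c, hc⟩ ((freeIncl E).map x) =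
    ksign k (q * s) • ((diamond h₃ (diamond hps θ ψ) φ).1 m n ⟨a, c, hc⟩ ((freeIncl E).map x) -
      (diamond h₄ θ (diamond hsq ψ φ)).1 m n ⟨a, c, hc⟩ ((freeIncl E).map x))
  rw [diamond_freeIncl h₁ _ ψ i₄ i₁ hc, diamond_freeIncl hpq θ φ rfl rfl i₄,
    diamond_freeIncl h₂ θ _ rfl i₂ hc, diamond_freeIncl h₃ _ φ i₅ i₃ hc,
    diamond_freeIncl hps θ ψ rfl rfl i₅, diamond_freeIncl h₄ θ _ rfl i₂ hc, map_smul, map_smul]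
  have key := tilde_commutator hqs hsq φ ψ i₂ rfl i₃ rfl i₁
    (θ.1 m n ⟨a, a + p, rfl⟩ ((freeIncl E).map x))
  -- Solved for `φ̃ψ̃(θ(x))`, which is thereby eliminated from the goal.
  rw [sub_eq_iff_eq_add] at key
  rw [key]
  subst hpq hps hqs
  simp only [mul_add, add_mul, ksign_add, mul_comm s q]
  obtain e | e := ksign_eq_or k (q * s) <;> rw [e] <;> module

end PreLie

end Markl

theorem mainTheorem3 {k : Type u} [Field k] [CharZero k]
    (E : Markl.GrBimod.{u, v₁} k) (Q : Markl.GrPROP.{u, v₃} k) :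
    -- restriction to the generators is an isomorphism `Der(M, M * Q) ≅ Lin(E, M * Q)`, where
    -- `M = F(E)`, so that `Ex` is its inverse
    (∀ d : ℤ, Function.Bijective
      (Markl.restrictGen (Markl.coprodInl (Markl.freePROP E) Q) d)) ∧
    -- restriction to `M` is an isomorphism between the derivations of `M * Q` that vanish on `Q`
    -- and `Der(M, M * Q)`, so that `φ ↦ φ̃` is its inverse
    (∀ d : ℤ, Function.Bijective (Markl.restrictLeft (Markl.freePROP E) Q d)) ∧
    -- the product `⋄` is a graded pre-Lie algebra structure on `Der(M, M * Q)`
    (∃ S : Markl.GrPreLie k (fun d => Markl.DerFree E Q d),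
      ∀ {p q r : ℤ} (h : p + q = r) (θ : Markl.DerFree E Q p) (φ : Markl.DerFree E Q q),
        S.mul h θ φ = Markl.diamond h θ φ) ∧
    -- the product `⋄` is natural in `E` and in `Q`
    (∀ (E' : Markl.GrBimod.{u, v₂} k) (Q' : Markl.GrPROP.{u, v₄} k)
      (g : Markl.GrBimodHom E E') (f : Markl.PROPHom Q Q') {p q r : ℤ} (h : p + q = r)
      (θ : Markl.DerFree E Q p) (φ : Markl.DerFree E Q q)
      (θ' : Markl.DerFree E' Q' p) (φ' : Markl.DerFree E' Q' q),
      Markl.Intertwined g f θ θ' → Markl.Intertwined g f φ φ' →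
        Markl.Intertwined g f (Markl.diamond h θ φ) (Markl.diamond h θ' φ')) := by

  -- Freeness of `M` is needed for the first bijection only; the second holds for an arbitrary left
  -- factor.
  refine ⟨Markl.restrictGen_bijective _, Markl.restrictLeft_bijective _ Q,
    ⟨⟨fun h => Markl.diamondHom E Q h, Markl.diamond_assoc_symm⟩, fun _ _ _ => rfl⟩, ?_⟩
  intro E' Q' g f p q r h θ φ θ' φ' hθ hφ
  exact hθ.diamond h hφ
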